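/- Let $S$ be a locally compact Hausdorff semitopological semigroup, i.e. a semigroup with a locally compact Hausdorff topology for which the multiplication is separately continuous. Let $C_b(S)$ be the Banach space of bounded continuous complex functions on $S$ and $C_0(S)$ the subspace of functions vanishing at infinity, and let $wap(S)$ be the set of $f\in C_b(S)$ for which the set of right translates $\{R_sf : s\in S\}$, $R_sf(t)=f(ts)$, is relatively weakly compact in $C_b(S)$. Let $M_b(S)$ be the space of complex regular Borel measures on $S$ with the total variation norm and the convolution product determined by $\int f\,d(\mu*\nu)=\int\!\int f(xy)\,d\mu(x)\,d\nu(y)$ for $f\in C_0(S)$; and let $\ell^1(S)$ (for $S$ discrete) carry the convolution product $(f*g)(s)=\sum_{xy=s}f(x)g(y)$. For a Banach algebra $A$, let $\mathcal{WAP}(A)$ be the subspace of those $f\in A^*$ for which $\{f\cdot a : \|a\|\le 1\}$ is relatively weakly compact in $A^*$, where $\langle f\cdot a,b\rangle=\langle f,ab\rangle$. $A$ is called a WAP-algebra if the natural map $\phi:A\to\mathcal{WAP}(A)^*$, $\phi(a)(f)=\langle f,a\rangle$, is bounded below, i.e. $\inf\{\|\phi(a)\| : \|a\|\ge 1\}>0$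 (with $\inf\emptyset=+\infty$). (1) If $C_0(S)\subseteq wap(S)$, then $M_b(S)$ is a Banach algebra under convolution (in particular, for all $\mu,\nu\in M_b(S)$ the iterated integrals above exist and define a measure $\mu*\nu\in M_b(S)$), and it is a WAP-algebra. (2) If $S$ is discrete and $c_0(S)\subseteq wap(S)$, then $\ell^1(S)$, with convolution, is a Banach algebra and a WAP-algebra. -/

import Mathlib

open MeasureTheory Filter Topology
open scoped BoundedContinuousFunction ZeroAtInfty ENNReal

noncomputable section

namespace WAPAlg

/-! ### Weak compactness -/

/-- A subset of a normed space is relatively weakly compact if its closure in the weak topology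
is compact. -/
def RelWeaklyCompact {E : Type*} [NormedAddCommGroup E] [NormedSpace ℂ E] (A : Set E) : Prop :=
  IsCompact (closure (toWeakSpace ℂ E '' A))

theorem RelWeaklyCompact.of_subset_image_add {E : Type*} [NormedAddCommGroup E] [NormedSpace ℂ E]
    {A B C : Set E} (hA : RelWeaklyCompact A) (hB : RelWeaklyCompact B)
    (hC : ∀ x ∈ C, ∃ a ∈ A, ∃ b ∈ B, x = a + b) : RelWeaklyCompact C := by
  have hK := (hA.prod hB).image (continuous_add (M := WeakSpace ℂ E))
  refine hK.closure_of_subset ?_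
  rintro _ ⟨x, hx, rfl⟩
  obtain ⟨a, ha, b, hb, rfl⟩ := hC x hx
  exact ⟨(toWeakSpace ℂ E a, toWeakSpace ℂ E b),
    ⟨subset_closure ⟨a, ha, rfl⟩, subset_closure ⟨b, hb, rfl⟩⟩, (map_add _ a b).symm⟩

theorem RelWeaklyCompact.of_subset_image_smul {E : Type*} [NormedAddCommGroup E]
    [NormedSpace ℂ E] {A C : Set E} (hA : RelWeaklyCompact A) (c : ℂ)
    (hC : ∀ x ∈ C, ∃ a ∈ A, x = c • a) : RelWeaklyCompact C := by
  have hK := hA.image (continuous_const_smul (T := WeakSpace ℂ E) c)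
  refine hK.closure_of_subset ?_
  rintro _ ⟨x, hx, rfl⟩
  obtain ⟨a, ha, rfl⟩ := hC x hx
  exact ⟨toWeakSpace ℂ E a, subset_closure ⟨a, ha, rfl⟩, (map_smul _ c a).symm⟩

/-! ### Banach algebras and WAP-algebras

A product on a normed space `A` is given as a bounded bilinear map `m : A →L[ℂ] A →L[ℂ] A`. -/

section Algebra

variable {A : Type*} [NormedAddCommGroup A] [NormedSpace ℂ A]

/-- `A` with the product `m` is a (not necessarily unital) complex Banach algebra. -/
structure IsBanachAlgebra (m : A →L[ℂ] A →L[ℂ] A) : Prop where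
  complete : CompleteSpace A
  assoc : ∀ a b c : A, m (m a b) c = m a (m b c)
  norm_mul_le : ∀ a b : A, ‖m a b‖ ≤ ‖a‖ * ‖b‖

/-- The right module action on the dual: `⟨f · a, b⟩ = ⟨f, a b⟩`. -/
def dualAct (m : A →L[ℂ] A →L[ℂ] A) (f : StrongDual ℂ A) (a : A) : StrongDual ℂ A :=
  f.comp (m a)

/-- The space of weakly almost periodic functionals: those `f` for which
`{f · a : ‖a‖ ≤ 1}` is relatively weakly compact in the dual. -/
def WAP (m : A →L[ℂ] A →L[ℂ] A) : Submodule ℂ (StrongDual ℂ A) where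
  carrier := {f | RelWeaklyCompact {g | ∃ a : A, ‖a‖ ≤ 1 ∧ g = dualAct m f a}}
  add_mem' := by
    intro f g hf hg
    refine RelWeaklyCompact.of_subset_image_add hf hg ?_
    rintro _ ⟨a, ha, rfl⟩
    exact ⟨_, ⟨a, ha, rfl⟩, _, ⟨a, ha, rfl⟩, rfl⟩
  zero_mem' := by
    refine (isCompact_singleton (x := (0 : WeakSpace ℂ (StrongDual ℂ A)))).closure_of_subset ?_
    rintro _ ⟨_, ⟨a, _, rfl⟩, rfl⟩
    simp [dualAct]
  smul_mem' := by
    intro c f hf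
    refine RelWeaklyCompact.of_subset_image_smul hf c ?_
    rintro _ ⟨a, ha, rfl⟩
    exact ⟨_, ⟨a, ha, rfl⟩, rfl⟩

/-- The restriction of a bounded functional to a linear subspace. -/
def restrictDual {E : Type*} [NormedAddCommGroup E] [NormedSpace ℂ E] (W : Submodule ℂ E)
    (φ : StrongDual ℂ E) : StrongDual ℂ W :=
  φ.comp W.subtypeL

/-- The natural map `A → WAP(A)^*`, `a ↦ (f ↦ f a)`. -/
def toDualWAP (m : A →L[ℂ] A →L[ℂ] A) (a : A) :=
  restrictDual (WAP m) (NormedSpace.inclusionInDoubleDual ℂ A a)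

/-- `inf {‖φ a‖ : ‖a‖ ≥ 1} > 0` (the infimum of the empty set being `+∞`). -/
def BoundedBelow {B : Type*} [NormedAddCommGroup B] (φ : A → B) : Prop :=
  ∃ c : ℝ, 0 < c ∧ ∀ a : A, 1 ≤ ‖a‖ → c ≤ ‖φ a‖

/-- A WAP-algebra: a Banach algebra `A` whose natural map into `WAP(A)^*` is bounded below. -/
structure IsWAPAlgebra (m : A →L[ℂ] A →L[ℂ] A) : Prop extends IsBanachAlgebra m where
  boundedBelow : BoundedBelow (toDualWAP m)

end Algebra

/-! ### Weakly almost periodic functions on a semitopological semigroup -/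

section Functions

variable {S : Type*} [TopologicalSpace S] [Semigroup S] [SeparatelyContinuousMul S]

/-- The right translate `t ↦ f (t s)`. -/
def rightTranslate (s : S) (f : S →ᵇ ℂ) : S →ᵇ ℂ :=
  f.compContinuous ⟨fun t => t * s, continuous_mul_const s⟩

variable (S) in
/-- `wap(S)`: the bounded continuous functions whose set of right translates is relatively
weakly compact in the Banach space of bounded continuous functions on `S`. -/
def wap : Set (S →ᵇ ℂ) := {f | RelWeaklyCompact (Set.range fun s : S => rightTranslate s f)}

end Functions

/-! ### The measure algebra -/

section Measures

variable {S : Type*} [MeasurableSpace S]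

instance isFiniteMeasure_variation (μ : ComplexMeasure S) : IsFiniteMeasure μ.variation := by
  have h : μ.variation ≤
      (ComplexMeasure.re μ).variation + (ComplexMeasure.im μ).variation := by
    refine VectorMeasure.variation_le_of_forall_enorm_le fun E _ => ?_
    have h1 : ‖μ E‖ₑ ≤ ‖(ComplexMeasure.re μ) E‖ₑ + ‖(ComplexMeasure.im μ) E‖ₑ := by
      rw [← ofReal_norm, ← ofReal_norm, ← ofReal_norm,
        ← ENNReal.ofReal_add (norm_nonneg _) (norm_nonneg _)]
      exact ENNReal.ofReal_le_ofReal (Complex.norm_le_abs_re_add_abs_im (μ E))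
    exact h1.trans (add_le_add (VectorMeasure.enorm_measure_le_variation _ _)
      (VectorMeasure.enorm_measure_le_variation _ _))
  have h2 : ∀ s : SignedMeasure S, IsFiniteMeasure s.variation := fun s => by
    rw [← SignedMeasure.totalVariation_eq_variation]
    unfold SignedMeasure.totalVariation
    infer_instance
  have := h2 (ComplexMeasure.re μ)
  have := h2 (ComplexMeasure.im μ)
  exact isFiniteMeasure_of_le _ h

variable [TopologicalSpace S] [T2Space S] [BorelSpace S]

theorem regular_of_le {μ ν : Measure S} [IsFiniteMeasure μ] [μ.Regular] (h : ν ≤ μ) :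
    ν.Regular := by
  have : IsFiniteMeasure ν := isFiniteMeasure_of_le μ h
  have : ν.InnerRegular := by
    refine ⟨fun A hA r hr => ?_⟩
    obtain ⟨K, hKA, hK, hlt⟩ := hA.exists_isCompact_sdiff_lt (μ := μ) (measure_ne_top _ _)
      (tsub_pos_of_lt hr).ne'
    refine ⟨K, hKA, hK, ?_⟩
    have h1 : ν (A \ K) < ν A - r := (h _).trans_lt hlt
    have h2 : ν A ≤ ν K + ν (A \ K) := by
      refine (measure_mono ?_).trans (measure_union_le _ _)
      intro x hx
      by_cases hxK : x ∈ K
      · exact Or.inl hxK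
      · exact Or.inr ⟨hx, hxK⟩
    by_contra hcon
    rw [not_lt] at hcon
    have h3 : ν A < ν A := calc
      ν A ≤ ν K + ν (A \ K) := h2
      _ ≤ r + ν (A \ K) := by gcongr
      _ < r + (ν A - r) := ENNReal.add_lt_add_left (ne_top_of_lt hr) h1
      _ = ν A := add_tsub_cancel_of_le hr.le
    exact lt_irrefl _ h3
  infer_instance

variable (S) in
/-- `M_b(S)`: the space of complex Borel measures on `S` with regular total variation. -/
def MeasureAlgebra : Submodule ℂ (ComplexMeasure S) where
  carrier := {μ | μ.variation.Regular}
  add_mem' := by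
    intro μ ν (hμ : μ.variation.Regular) (hν : ν.variation.Regular)
    have : (μ.variation + ν.variation).Regular := inferInstance
    exact regular_of_le VectorMeasure.variation_add_le
  zero_mem' := by
    change (0 : ComplexMeasure S).variation.Regular
    rw [VectorMeasure.variation_zero]
    infer_instance
  smul_mem' := by
    intro c μ (hμ : μ.variation.Regular)
    change (c • μ).variation.Regular
    rw [VectorMeasure.variation_smul]
    infer_instance

/-- The total variation norm `‖μ‖ = |μ|(S)`. -/
instance : Norm (MeasureAlgebra S) := ⟨fun μ => μ.1.variation.real Set.univ⟩

theorem measureAlgebra_core : NormedSpace.Core ℂ (MeasureAlgebra S) where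
  norm_nonneg _ := measureReal_nonneg
  norm_smul c μ := by
    change (c • μ.1).variation.real Set.univ = ‖c‖ * μ.1.variation.real Set.univ
    rw [VectorMeasure.variation_smul]
    simp [Measure.real]
  norm_triangle μ ν := by
    change (μ.1 + ν.1).variation.real Set.univ ≤
      μ.1.variation.real Set.univ + ν.1.variation.real Set.univ
    rw [← measureReal_add_apply]
    exact ENNReal.toReal_mono (measure_ne_top _ _) (VectorMeasure.variation_add_le _)
  norm_eq_zero_iff μ := by
    change μ.1.variation.real Set.univ = 0 ↔ _
    rw [measureReal_eq_zero_iff, Measure.measure_univ_eq_zero, VectorMeasure.variation_eq_zero]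
    exact Submodule.coe_eq_zero

instance : NormedAddCommGroup (MeasureAlgebra S) := NormedAddCommGroup.ofCore measureAlgebra_core

instance : NormedSpace ℂ (MeasureAlgebra S) := NormedSpace.ofCore measureAlgebra_core

/-- The integral `∫ f dμ` of a complex function against a complex measure. -/
def cintegral (μ : MeasureAlgebra S) (f : S → ℂ) : ℂ :=
  VectorMeasure.integral μ.1 f (ContinuousLinearMap.mul ℝ ℂ)

/-- `ρ` is the convolution `μ * ν`, that is,
`∫ f dρ = ∫ (∫ f(xy) dμ(x)) dν(y)` for all `f ∈ C₀(S)`. A regular measure is determined by its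
integrals against `C₀(S)`, so there is at most one such `ρ`. -/
def IsConvolution [Mul S] (μ ν ρ : MeasureAlgebra S) : Prop :=
  ∀ f : C₀(S, ℂ),
    VectorMeasure.Integrable ν.1 (fun y => cintegral μ fun x => f (x * y)) ∧
    cintegral ρ f = cintegral ν fun y => cintegral μ fun x => f (x * y)

end Measures

/-! ### The discrete semigroup algebra -/

/-- The Banach space `ℓ¹(S)`. -/
abbrev Ell1 (S : Type*) : Type _ := lp (fun _ : S => ℂ) 1

/-- `h` is the convolution `f * g` in `ℓ¹(S)`: `h(s) = ∑_{xy = s} f(x) g(y)`. -/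
def IsConvolutionEll1 {S : Type*} [Mul S] (f g h : Ell1 S) : Prop :=
  ∀ s : S, HasSum (fun p : {p : S × S // p.1 * p.2 = s} => f p.1.1 * g p.1.2) (h s)

end WAPAlg

end

/-!
Both parts are instances of one statement about a normed space `M` that acts on the bounded
continuous functions by a pairing `J μ g`, thought of as `∫ g dμ` (`IsConvolutionModel`).

Write `average μ g` for the function `y ↦ ∫ g(xy) dμ(x)`. If these functions are continuous, and if
every `g ↦ J ν (average μ g)` is given by an element of `M`, then this element is the product of `μ`
and `ν`. The product is associative because multiplication in `S` is, and submultiplicative because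
`‖average μ g‖ ≤ ‖μ‖ ‖g‖`. Let now `f` be weakly almost periodic on `S`. Then `μ ↦ J μ f` is a
weakly almost periodic functional on `M` (`IsConvolutionModel.flip_apply_mem_WAP`). Indeed, by
Grothendieck's criterion (`relWeaklyCompact_of_iteratedLimits`) it is enough to interchange the
iterated limits of `J (μ n * ν m) f`, which is the integral against `ν m` of the function
`y ↦ J (μ n) (rightTranslate y f)`. The latter extends continuously to the weak closure `K` of the
orbit of `f`, and `K` is compact by hypothesis. All ultrafilter limits of the functions obtained on
`K` are again given by bounded functionals, hence continuous. A sequence with this property has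
ultrafilter limits that are limits of sequences of its members, so that dominated convergence
applies along ultrafilters (`tendsto_integral_ultrafilter`); together with weak-* compactness of
bounded sets of measures on `K` this gives the interchange (`exists_iteratedLimits_integral`). If
moreover the weakly almost periodic functions determine the norm of `M`, then so do the weakly
almost periodic functionals, and `M` is a WAP-algebra.

For `M_b(S)` the norm is determined by `C₀(S)`, which consists of weakly almost periodic functions
by hypothesis. What has to be shown is that convolutions exist although multiplication is only
separately continuous. For compactly supported `f`, the function `y ↦ ∫ f(xy) dp(x)` is continuous
since weakly almost periodic functions are translated weakly continuously. This and the regularity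
of `p` show that the translates of `p` are tight, locally uniformly
(`exists_eventually_integral_one_sub_lt`), whence continuity for all bounded `f`. The convolution of
two positive measures is then given by the Riesz representation theorem, and by tightness its
defining formula holds for all bounded continuous functions
(`exists_measure_integral_eq_integral_integral`).

For `ℓ¹(S)` continuity is no issue and the product is given by an absolutely convergent double sum.
-/

namespace WAPAlg

/-! ### Weak compactness from interchanging double limits -/

section DoubleLimit

variable {M : Type*} [NormedAddCommGroup M] [NormedSpace ℂ M]

/-- **Goldstine's theorem**, for finitely many functionals at a time: a bidual element is
approximated on a finite set of functionals by points of a ball of slightly larger radius. -/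
theorem exists_norm_le_forall_norm_sub_lt (Θ : StrongDual ℂ (StrongDual ℂ M))
    (F : Finset (StrongDual ℂ M)) {ε : ℝ} (hε : 0 < ε) :
    ∃ b : M, ‖b‖ ≤ ‖Θ‖ + 1 ∧ ∀ φ ∈ F, ‖φ b - Θ φ‖ < ε := by
  classical
  set R : ℝ := ‖Θ‖ + 1 with hR
  have hRpos : 0 < R := by positivity
  let q : M →L[ℂ] (F → ℂ) := ContinuousLinearMap.pi fun φ => φ.1
  let z : F → ℂ := fun φ => Θ φ.1
  have hz : z ∈ closure (q '' Metric.closedBall 0 R) := by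
    by_contra hz
    have hconv : Convex ℝ (q '' Metric.closedBall 0 R) :=
      (convex_closedBall (0 : M) R).is_linear_image
        ⟨fun x y => map_add q x y, fun c x => q.map_smul_of_tower c x⟩
    obtain ⟨ℓ, u, hu, hlt⟩ := RCLike.geometric_hahn_banach_closed_point (𝕜 := ℂ)
      hconv.closure isClosed_closure hz
    let ψ : StrongDual ℂ M := ℓ.comp q
    -- the separating functional, pulled back to `M`, is a combination of the members of `F`
    have hexp : ∀ w : F → ℂ, ℓ w = ∑ φ, w φ * ℓ (Pi.single φ 1) := by
      intro w
      conv_lhs => rw [pi_eq_sum_univ' w]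
      simp [map_sum]
    have hψ : ψ = ∑ φ : F, ℓ (Pi.single φ 1) • φ.1 := by
      ext b
      simp only [ψ, ContinuousLinearMap.comp_apply, hexp (q b)]
      simp [q, mul_comm]
    have hΘ : Θ ψ = ℓ z := by
      rw [hψ, hexp z]
      simp [z, mul_comm]
    have hb : ∀ b : M, ‖b‖ ≤ R → RCLike.re (ψ b) < u := fun b hb =>
      hu _ (subset_closure ⟨b, by simpa using hb, rfl⟩)
    have hu0 : 0 < u := by simpa using hb 0 (by simpa using hRpos.le)
    have hnorm : ‖ψ‖ ≤ u / R := by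
      refine ContinuousLinearMap.opNorm_le_bound _ (by positivity) fun x => ?_
      rcases eq_or_ne (ψ x) 0 with h0 | h0
      · rw [h0, norm_zero]; positivity
      have hx : x ≠ 0 := by rintro rfl; simp at h0
      have hxn : 0 < ‖x‖ := norm_pos_iff.2 hx
      -- rotate and rescale `x` so that `ψ` takes a real value at the boundary of the ball
      let c : ℂ := (R / ‖x‖ : ℝ) * ((starRingEnd ℂ) (ψ x) / ‖ψ x‖)
      have hcn : ‖c • x‖ ≤ R := by
        have : ‖(starRingEnd ℂ) (ψ x) / (‖ψ x‖ : ℂ)‖ = 1 := by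
          simp [h0]
        rw [norm_smul, norm_mul, this, mul_one, Complex.norm_real, Real.norm_eq_abs,
          abs_of_pos (by positivity), div_mul_cancel₀ _ hxn.ne']
      have h1 := hb (c • x) hcn
      have h2 : ψ (c • x) = ((R / ‖x‖ * ‖ψ x‖ : ℝ) : ℂ) := by
        rw [map_smul, smul_eq_mul]
        have h3 : (starRingEnd ℂ) (ψ x) * ψ x = ((‖ψ x‖ : ℂ)) ^ 2 := by
          rw [mul_comm, Complex.mul_conj]; norm_cast; rw [Complex.normSq_eq_norm_sq]
        have h4 : (‖ψ x‖ : ℂ) ≠ 0 := by simpa using h0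
        simp only [c]
        rw [mul_assoc, div_mul_eq_mul_div, h3]
        push_cast
        field_simp
      rw [h2] at h1
      simp only [RCLike.re_to_complex, Complex.ofReal_re] at h1
      rw [div_mul_eq_mul_div, le_div_iff₀ hRpos]
      rw [div_mul_eq_mul_div, div_lt_iff₀ hxn] at h1
      linarith
    have h1 : RCLike.re (ℓ z) ≤ ‖Θ‖ * (u / R) := by
      rw [← hΘ]
      calc RCLike.re (Θ ψ) ≤ ‖Θ ψ‖ := RCLike.re_le_norm _
        _ ≤ ‖Θ‖ * ‖ψ‖ := Θ.le_opNorm ψ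
        _ ≤ _ := by gcongr
    have h2 : ‖Θ‖ * (u / R) ≤ u := by
      rw [← mul_div_assoc, div_le_iff₀ hRpos, hR]
      nlinarith [norm_nonneg Θ]
    linarith
  obtain ⟨_, ⟨b, hb, rfl⟩, hlt⟩ := Metric.mem_closure_iff.1 hz ε hε
  refine ⟨b, by simpa using hb, fun φ hφ => ?_⟩
  have := (dist_pi_lt_iff hε).1 hlt ⟨φ, hφ⟩
  rwa [dist_comm, dist_eq_norm] at this

/-- A weak-* limit of points of the image of the unit ball is approximated by such points at
finitely many places. -/
theorem exists_norm_le_forall_norm_sub_lt_of_mem_closure (T : M →L[ℂ] StrongDual ℂ M)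
    {Φ : WeakDual ℂ (StrongDual ℂ (StrongDual ℂ M))}
    (hΦ : Φ ∈ closure (NormedSpace.inclusionInDoubleDualWeak ℂ (StrongDual ℂ M) ''
      (toWeakSpace ℂ (StrongDual ℂ M) '' {g | ∃ a : M, ‖a‖ ≤ 1 ∧ g = T a})))
    (G : Finset (StrongDual ℂ (StrongDual ℂ M))) {ε : ℝ} (hε : 0 < ε) :
    ∃ a : M, ‖a‖ ≤ 1 ∧ ∀ Λ ∈ G, ‖Λ (T a) - Φ Λ‖ < ε := by
  have hmem : ∀ᶠ Φ' in 𝓝 Φ, ∀ Λ ∈ G, ‖Φ' Λ - Φ Λ‖ < ε := by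
    refine (Finset.eventually_all G).2 fun Λ _ => ?_
    have hc : Continuous fun Φ' : WeakDual ℂ (StrongDual ℂ (StrongDual ℂ M)) =>
        ‖Φ' Λ - Φ Λ‖ := ((WeakDual.eval_continuous Λ).sub continuous_const).norm
    exact hc.continuousAt.eventually_lt continuousAt_const (by simpa using hε)
  obtain ⟨_, hx, ⟨_, ⟨_, ⟨a, ha, rfl⟩, rfl⟩, rfl⟩⟩ := mem_closure_iff_nhds.1 hΦ _ hmem
  exact ⟨a, ha, hx⟩

/-- **Grothendieck's double limit criterion** for an operator from a space to its dual: if the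
iterated limits of `T (a n) (b m)` agree whenever they exist, then `T` is weakly compact. -/
theorem relWeaklyCompact_of_iteratedLimits (T : M →L[ℂ] StrongDual ℂ M)
    (h : ∀ a b : ℕ → M, (∀ n, ‖a n‖ ≤ 1) → (∃ C, ∀ n, ‖b n‖ ≤ C) →
      ∀ (α β : ℕ → ℂ) (s t : ℂ),
        (∀ m, Tendsto (fun n => T (a n) (b m)) atTop (𝓝 (α m))) → Tendsto α atTop (𝓝 s) →
        (∀ n, Tendsto (fun m => T (a n) (b m)) atTop (𝓝 (β n))) → Tendsto β atTop (𝓝 t) →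
        s = t) :
    RelWeaklyCompact {g | ∃ a : M, ‖a‖ ≤ 1 ∧ g = T a} := by
  classical
  refine NormedSpace.isCompact_closure_of_isBounded ℂ (StrongDual ℂ M) _ ?_ ?_
  · rw [(toWeakSpace ℂ (StrongDual ℂ M)).injective.preimage_image]
    refine isBounded_iff_forall_norm_le.2 ⟨‖T‖, ?_⟩
    rintro _ ⟨a, ha, rfl⟩
    exact T.unit_le_opNorm a ha
  intro Φ hΦ
  -- the candidate for a preimage of `Φ` is its restriction to `M`
  let Φ₀ : StrongDual ℂ M :=
    (WeakDual.toStrongDual Φ).comp (NormedSpace.inclusionInDoubleDual ℂ M)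
  have hΦ₀ : ∀ b, Φ₀ b = Φ (NormedSpace.inclusionInDoubleDual ℂ M b) := fun _ => rfl
  refine ⟨toWeakSpace ℂ _ Φ₀, ?_⟩
  refine DFunLike.ext _ _ fun Θ => ?_
  change Θ Φ₀ = Φ Θ
  -- choose inductively `a`'s approximating `Φ` and `b`'s approximating `Θ`, each on the vectors
  -- already chosen; the iterated limits of `T (a n) (b m)` are then `Θ Φ₀` and `Φ Θ`
  have happ := exists_norm_le_forall_norm_sub_lt_of_mem_closure T hΦ
  let P : M × M × ℕ → Prop := fun x => ‖x.1‖ ≤ 1 ∧ ‖x.2.1‖ ≤ ‖Θ‖ + 1 ∧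
    ‖Φ₀ x.2.1 - Θ Φ₀‖ < 1 / ((x.2.2 : ℝ) + 1) ∧ ‖Θ (T x.1) - Φ Θ‖ < 1 / ((x.2.2 : ℝ) + 1)
  let r : M × M × ℕ → M × M × ℕ → Prop := fun x y => x.2.2 < y.2.2 ∧
    ‖T x.1 y.2.1 - Θ (T x.1)‖ < 1 / ((y.2.2 : ℝ) + 1) ∧
    ‖T y.1 x.2.1 - Φ₀ x.2.1‖ < 1 / ((y.2.2 : ℝ) + 1)
  obtain ⟨x, hxP, hxr⟩ := exists_seq_of_forall_finset_exists P r (by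
    intro s _
    let k : ℕ := s.sup (fun x => x.2.2) + 1
    have hk : (0 : ℝ) < 1 / ((k : ℝ) + 1) := by positivity
    obtain ⟨b, hb, hbF⟩ := exists_norm_le_forall_norm_sub_lt Θ
      (insert Φ₀ (s.image fun x => T x.1)) hk
    obtain ⟨a, ha, haΘ, haG⟩ : ∃ a : M, ‖a‖ ≤ 1 ∧ ‖Θ (T a) - Φ Θ‖ < 1 / ((k : ℝ) + 1) ∧
        ∀ y ∈ s, ‖T a y.2.1 - Φ₀ y.2.1‖ < 1 / ((k : ℝ) + 1) := by
      obtain ⟨a, ha, haG⟩ := happ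
        (insert Θ (s.image fun x : M × M × ℕ => NormedSpace.inclusionInDoubleDual ℂ M x.2.1)) hk
      refine ⟨a, ha, haG _ (Finset.mem_insert_self _ _), fun y hy => ?_⟩
      have h1 := haG _ (Finset.mem_insert_of_mem
        (Finset.mem_image_of_mem
          (fun x : M × M × ℕ => NormedSpace.inclusionInDoubleDual ℂ M x.2.1) hy))
      rwa [← hΦ₀, NormedSpace.dual_def] at h1
    refine ⟨(a, b, k), ⟨ha, hb, hbF _ (Finset.mem_insert_self _ _), haΘ⟩,
      fun y hy => ⟨?_, ?_, haG y hy⟩⟩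
    · exact Nat.lt_succ_of_le (Finset.le_sup (f := fun x : M × M × ℕ => x.2.2) hy)
    · exact hbF _ (Finset.mem_insert_of_mem
        (Finset.mem_image_of_mem (fun x : M × M × ℕ => T x.1) hy)))
  have hmono : StrictMono fun n => (x n).2.2 := fun m n hmn => (hxr m n hmn).1
  have hlim : Tendsto (fun n => 1 / (((x n).2.2 : ℝ) + 1)) atTop (𝓝 0) :=
    tendsto_one_div_add_atTop_nhds_zero_nat.comp hmono.tendsto_atTop
  refine h (fun n => (x n).1) (fun n => (x n).2.1) (fun n => (hxP n).1)
    ⟨_, fun n => (hxP n).2.1⟩ (fun m => Φ₀ (x m).2.1) (fun n => Θ (T (x n).1)) _ _ ?_ ?_ ?_ ?_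
  · intro m
    refine tendsto_iff_norm_sub_tendsto_zero.2 (squeeze_zero' (.of_forall fun _ => norm_nonneg _)
      ?_ hlim)
    filter_upwards [eventually_gt_atTop m] with n hn using (hxr m n hn).2.2.le
  · exact tendsto_iff_norm_sub_tendsto_zero.2 (squeeze_zero (fun _ => norm_nonneg _)
      (fun n => (hxP n).2.2.1.le) hlim)
  · intro n
    refine tendsto_iff_norm_sub_tendsto_zero.2 (squeeze_zero' (.of_forall fun _ => norm_nonneg _)
      ?_ hlim)
    filter_upwards [eventually_gt_atTop n] with m hm using (hxr n m hm).2.1.le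
  · exact tendsto_iff_norm_sub_tendsto_zero.2 (squeeze_zero (fun _ => norm_nonneg _)
      (fun n => (hxP n).2.2.2.le) hlim)

end DoubleLimit

/-! ### Iterated limits of integrals over a compact space -/

section Compact

variable {K : Type*} [TopologicalSpace K] [CompactSpace K] {φ : ℕ → K → ℂ} {φ₀ : K → ℂ}
  {U : Ultrafilter ℕ}

/-- If all ultrafilter limits of a sequence of continuous functions on a compact space are
continuous, then each of them is a pointwise limit of a sequence of members, which can moreover be
picked from any given set of the ultrafilter. -/
theorem exists_seq_tendsto_of_ultrafilter (hφ : ∀ m, Continuous (φ m))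
    (hV : ∀ V : Ultrafilter ℕ, ∃ g, Continuous g ∧ ∀ k, Tendsto (fun m => φ m k) V (𝓝 (g k)))
    (h₀ : ∀ k, Tendsto (fun m => φ m k) U (𝓝 (φ₀ k))) {N : Set ℕ} (hN : N ∈ U) :
    ∃ m : ℕ → ℕ, (∀ i, m i ∈ N) ∧ ∀ k, Tendsto (fun i => φ (m i) k) atTop (𝓝 (φ₀ k)) := by
  rcases isEmpty_or_nonempty K with hK | hK
  · obtain ⟨n, hn⟩ := U.nonempty_of_mem hN
    exact ⟨fun _ => n, fun _ => hn, fun k => isEmptyElim k⟩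
  have hφ₀ : Continuous φ₀ := by
    obtain ⟨g, hg, hlim⟩ := hV U
    rwa [funext fun k => tendsto_nhds_unique (h₀ k) (hlim k)]
  -- the range of `q` is separable, being metrizable, and `D` is a sequence with dense image
  let q : K → ℕ → ℂ := fun k m => φ m k
  have hq : Continuous q := continuous_pi hφ
  obtain ⟨u, hu⟩ := TopologicalSpace.exists_dense_seq (Set.range q)
  choose D hD using fun i => (u i).2
  have hchoose : ∀ i : ℕ, ∃ m ∈ N, ∀ j ≤ i, dist (φ m (D j)) (φ₀ (D j)) < 1 / ((i : ℝ) + 1) := by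
    intro i
    have h1 : ∀ᶠ m in (U : Filter ℕ), ∀ j ∈ Finset.range (i + 1),
        dist (φ m (D j)) (φ₀ (D j)) < 1 / ((i : ℝ) + 1) :=
      (Finset.eventually_all _).2 fun j _ =>
        (Metric.tendsto_nhds.1 (h₀ (D j))) _ (by positivity)
    obtain ⟨m, hm, hmN⟩ := (h1.and hN).exists
    exact ⟨m, hmN, fun j hj => hm j (Finset.mem_range_succ_iff.2 hj)⟩
  choose m hmN hm using hchoose
  refine ⟨m, hmN, fun k => tendsto_iff_ultrafilter _ _ _ |>.2 fun W hW => ?_⟩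
  obtain ⟨g, hg, hglim⟩ := hV (W.map m)
  have hglim' : ∀ k, Tendsto (fun i => φ (m i) k) W (𝓝 (g k)) := fun k => hglim k
  have hgD : ∀ j, g (D j) = φ₀ (D j) := by
    intro j
    refine tendsto_nhds_unique (hglim' (D j)) (Tendsto.mono_left ?_ hW)
    refine tendsto_iff_dist_tendsto_zero.2 (squeeze_zero' (.of_forall fun _ => dist_nonneg) ?_
      tendsto_one_div_add_atTop_nhds_zero_nat)
    filter_upwards [eventually_ge_atTop j] with i hi using (hm i j hi).le
  -- `g` and `φ₀` agree on a closed set whose image under `q` is all of the range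
  have hZ : IsClosed (q '' {k | g k = φ₀ k}) :=
    ((isClosed_eq hg hφ₀).isCompact.image hq).isClosed
  have hk : q k ∈ q '' {k | g k = φ₀ k} := by
    have h1 : closure (Set.range u) ⊆ ((↑) : Set.range q → ℕ → ℂ) ⁻¹' (q '' {k | g k = φ₀ k}) := by
      refine closure_minimal ?_ (hZ.preimage continuous_subtype_val)
      rintro _ ⟨i, rfl⟩
      exact ⟨D i, hgD i, hD i⟩
    exact h1 (hu ⟨q k, k, rfl⟩)
  obtain ⟨k', hk', hkk'⟩ := hk
  have hval : ∀ m, φ m k' = φ m k := fun m => congrFun hkk' m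
  have e1 : φ₀ k' = φ₀ k := tendsto_nhds_unique (h₀ k') (by simpa only [hval] using h₀ k)
  have e2 : g k' = g k := tendsto_nhds_unique (hglim' k') (by simpa only [hval] using hglim' k)
  rw [← e1, ← hk', e2]
  exact hglim' k

/-- Dominated convergence along an ultrafilter. For general functions it fails; here it reduces to
sequences by `exists_seq_tendsto_of_ultrafilter`. -/
theorem tendsto_integral_ultrafilter (hφ : ∀ m, Continuous (φ m)) {C : ℝ}
    (hC : ∀ m k, ‖φ m k‖ ≤ C)
    (hV : ∀ V : Ultrafilter ℕ, ∃ g, Continuous g ∧ ∀ k, Tendsto (fun m => φ m k) V (𝓝 (g k)))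
    (h₀ : ∀ k, Tendsto (fun m => φ m k) U (𝓝 (φ₀ k)))
    {Y : Type*} [MeasurableSpace Y] (p : Measure Y) [IsFiniteMeasure p] (r : Y → K)
    (hr : ∀ m, AEStronglyMeasurable (fun y => φ m (r y)) p) :
    Tendsto (fun m => ∫ y, φ m (r y) ∂p) U (𝓝 (∫ y, φ₀ (r y) ∂p)) := by
  rw [Metric.tendsto_nhds]
  intro ε hε
  by_contra hcon
  obtain ⟨m, hm, hlim⟩ := exists_seq_tendsto_of_ultrafilter hφ hV h₀
    (Ultrafilter.eventually_not.2 hcon)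
  have h1 : Tendsto (fun i => ∫ y, φ (m i) (r y) ∂p) atTop (𝓝 (∫ y, φ₀ (r y) ∂p)) :=
    tendsto_integral_of_dominated_convergence (fun _ => C) (fun i => hr (m i))
      (integrable_const C) (fun i => .of_forall fun y => hC _ _) (.of_forall fun y => hlim (r y))
  obtain ⟨i, hi⟩ := ((Metric.tendsto_nhds.1 h1) ε hε).exists
  exact hm i hi

/-- The two iterated limits of `∫ φ m (r y) dp n` along an ultrafilter exist and agree. Their
common value is the integral of the limit of `φ` against the limit of the image measures. -/
theorem exists_iteratedLimits_integral [T2Space K] (hφ : ∀ m, Continuous (φ m)) {C : ℝ}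
    (hC : ∀ m k, ‖φ m k‖ ≤ C)
    (hV : ∀ V : Ultrafilter ℕ, ∃ g, Continuous g ∧ ∀ k, Tendsto (fun m => φ m k) V (𝓝 (g k)))
    (U : Ultrafilter ℕ)
    {Y : Type*} [TopologicalSpace Y] [MeasurableSpace Y] [OpensMeasurableSpace Y]
    {r : Y → K} (hr : Continuous r) (p : ℕ → Measure Y) [∀ n, IsFiniteMeasure (p n)] {C' : ℝ}
    (hp : ∀ n, (p n).real Set.univ ≤ C') :
    ∃ (α β : ℕ → ℂ) (s : ℂ),
      (∀ m, Tendsto (fun n => ∫ y, φ m (r y) ∂p n) U (𝓝 (α m))) ∧ Tendsto α U (𝓝 s) ∧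
      (∀ n, Tendsto (fun m => ∫ y, φ m (r y) ∂p n) U (𝓝 (β n))) ∧ Tendsto β U (𝓝 s) := by
  let _ : MeasurableSpace K := borel K
  have : BorelSpace K := ⟨rfl⟩
  obtain ⟨φ₀, hφ₀, h₀⟩ := hV U
  have hφ₀C : ∀ k, ‖φ₀ k‖ ≤ C := fun k =>
    le_of_tendsto (h₀ k).norm (.of_forall fun m => hC m k)
  let P : ℕ → FiniteMeasure K := fun n => ⟨(p n).map r, inferInstance⟩
  have hPmass : ∀ n, P n ∈ {μ : FiniteMeasure K | μ.mass ≤ C'.toNNReal} := by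
    intro n
    have h1 : ((P n).mass : ℝ) = (p n).real Set.univ := by
      change ((p n).map r Set.univ).toReal = _
      rw [Measure.map_apply hr.measurable MeasurableSet.univ, Set.preimage_univ]; rfl
    change (P n).mass ≤ _
    rw [← NNReal.coe_le_coe, h1]
    exact (hp n).trans (Real.le_coe_toNNReal _)
  obtain ⟨Q, -, hQ⟩ := (isCompact_setOfPred_finiteMeasure_le_of_compactSpace
    (E := K) C'.toNNReal).ultrafilter_le_nhds (U.map P)
      (le_principal_iff.2 (Filter.mem_map.2 (univ_mem' hPmass)))
  have hQ' : Tendsto P U (𝓝 Q) := hQ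
  have hint : ∀ g : K → ℂ, Continuous g → (∀ k, ‖g k‖ ≤ C) →
      Tendsto (fun n => ∫ y, g (r y) ∂p n) U (𝓝 (∫ k, g k ∂(Q : Measure K))) := by
    intro g hg hgC
    have h1 := (FiniteMeasure.tendsto_iff_forall_integral_rclike_tendsto ℂ).1 hQ'
      (BoundedContinuousFunction.ofNormedAddCommGroup g hg C hgC)
    refine h1.congr fun n => ?_
    exact integral_map hr.aemeasurable hg.aestronglyMeasurable
  exact ⟨_, _, _, fun m => hint (φ m) (hφ m) (hC m),
    tendsto_integral_ultrafilter hφ hC hV h₀ (Q : Measure K) id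
      fun m => (hφ m).aestronglyMeasurable,
    fun n => tendsto_integral_ultrafilter hφ hC hV h₀ (p n) r
      fun m => ((hφ m).comp hr).aestronglyMeasurable, hint φ₀ hφ₀ hφ₀C⟩

end Compact

/-! ### Weakly almost periodic functions -/

section Translates

variable {S : Type*} [TopologicalSpace S] [Semigroup S] [SeparatelyContinuousMul S]

@[simp]
theorem rightTranslate_apply (s : S) (f : S →ᵇ ℂ) (t : S) : rightTranslate s f t = f (t * s) := rfl

theorem rightTranslate_rightTranslate (s t : S) (f : S →ᵇ ℂ) :
    rightTranslate s (rightTranslate t f) = rightTranslate (s * t) f := by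
  ext x; simp [mul_assoc]

theorem norm_rightTranslate_le (s : S) (f : S →ᵇ ℂ) : ‖rightTranslate s f‖ ≤ ‖f‖ :=
  (BoundedContinuousFunction.norm_le (norm_nonneg f)).2 fun t => f.norm_coe_le_norm (t * s)

instance {E : Type*} [NormedAddCommGroup E] [NormedSpace ℂ E] : T2Space (WeakSpace ℂ E) :=
  (NormedSpace.isEmbedding_inclusionInDoubleDualWeak ℂ E).t2Space

theorem continuous_toWeakSpace_symm_apply {E : Type*} [NormedAddCommGroup E] [NormedSpace ℂ E]
    (Ψ : StrongDual ℂ E) : Continuous fun x : WeakSpace ℂ E => Ψ ((toWeakSpace ℂ E).symm x) :=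
  WeakBilin.eval_continuous (topDualPairing ℂ E).flip Ψ

/-- Translation moves a weakly almost periodic function weakly continuously: on the weakly compact
closure of the orbit, the weak topology is the topology of pointwise convergence. -/
theorem continuous_toWeakSpace_rightTranslate {f : S →ᵇ ℂ} (hf : f ∈ wap S) :
    Continuous fun y : S => toWeakSpace ℂ (S →ᵇ ℂ) (rightTranslate y f) := by
  let K : Set (WeakSpace ℂ (S →ᵇ ℂ)) :=
    closure (toWeakSpace ℂ (S →ᵇ ℂ) '' Set.range fun s : S => rightTranslate s f)
  have : CompactSpace K := isCompact_iff_compactSpace.1 hf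
  let ev : K → S → ℂ := fun x t => (toWeakSpace ℂ (S →ᵇ ℂ)).symm x.1 t
  have hev : Continuous ev := continuous_pi fun t =>
    (continuous_toWeakSpace_symm_apply (BoundedContinuousFunction.evalCLM ℂ t)).comp
      continuous_subtype_val
  have hinj : Function.Injective ev := fun x y hxy =>
    Subtype.ext ((toWeakSpace ℂ (S →ᵇ ℂ)).symm.injective (DFunLike.ext _ _ (congrFun hxy)))
  let r : S → K := fun y => ⟨toWeakSpace ℂ (S →ᵇ ℂ) (rightTranslate y f),
    subset_closure ⟨_, ⟨y, rfl⟩, rfl⟩⟩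
  have hr : Continuous r := (hev.isClosedEmbedding hinj).isInducing.continuous_iff.2
    (continuous_pi fun t => f.continuous.comp (continuous_const_mul t))
  exact continuous_subtype_val.comp hr

theorem continuous_apply_rightTranslate_of_mem_wap {f : S →ᵇ ℂ} (hf : f ∈ wap S)
    (Ψ : StrongDual ℂ (S →ᵇ ℂ)) : Continuous fun y : S => Ψ (rightTranslate y f) :=
  (continuous_toWeakSpace_symm_apply Ψ).comp (continuous_toWeakSpace_rightTranslate hf)

end Translates

/-- A bounded sequence of functionals has limits along ultrafilters in the weak-* sense. -/
theorem exists_ultrafilter_limit {E : Type*} [NormedAddCommGroup E] [NormedSpace ℂ E]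
    {Ψ : ℕ → StrongDual ℂ E} {C : ℝ} (hΨ : ∀ n, ‖Ψ n‖ ≤ C) (V : Ultrafilter ℕ) :
    ∃ Ψ₀ : StrongDual ℂ E, ∀ x, Tendsto (fun n => Ψ n x) V (𝓝 (Ψ₀ x)) := by
  have hmem : ∀ n, StrongDual.toWeakDual (Ψ n) ∈
      WeakDual.toStrongDual ⁻¹' Metric.closedBall (0 : StrongDual ℂ E) C := fun n => by
    simpa using hΨ n
  obtain ⟨Φ, -, hΦ⟩ := (WeakDual.isCompact_closedBall (0 : StrongDual ℂ E) C).ultrafilter_le_nhds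
    (V.map fun n => StrongDual.toWeakDual (Ψ n))
    (le_principal_iff.2 (Filter.mem_map.2 (univ_mem' hmem)))
  exact ⟨WeakDual.toStrongDual Φ, fun x => ((WeakDual.eval_continuous x).tendsto Φ).comp hΦ⟩

theorem norm_apply_le_norm_toDualWAP {A : Type*} [NormedAddCommGroup A] [NormedSpace ℂ A]
    (m : A →L[ℂ] A →L[ℂ] A) {ξ : StrongDual ℂ A} (hξ : ξ ∈ WAP m) (hξ1 : ‖ξ‖ ≤ 1) (a : A) :
    ‖ξ a‖ ≤ ‖toDualWAP m a‖ :=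
  (toDualWAP m a).unit_le_opNorm ⟨ξ, hξ⟩ hξ1

/-! ### Spaces of measures closed under convolution -/

section Model

variable {S : Type*} [TopologicalSpace S] [MeasurableSpace S] [Semigroup S]
  [SeparatelyContinuousMul S]
variable {M : Type*} [NormedAddCommGroup M] [NormedSpace ℂ M]

/-- A normed space `M` of "measures", acting by `J` on the bounded continuous functions, for which
convolution makes sense. This covers both `M_b(S)` and `ℓ¹(S)`. -/
structure IsConvolutionModel (J : M →L[ℂ] StrongDual ℂ (S →ᵇ ℂ)) : Prop where
  norm_le : ∀ μ, ‖J μ‖ ≤ ‖μ‖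
  /-- The weakly almost periodic functions determine the norm. -/
  norming : ∀ μ, ∀ ε > 0, ∃ f ∈ wap S, ‖f‖ ≤ 1 ∧ ‖μ‖ - ε ≤ ‖J μ f‖
  /-- Every element is a combination of positive measures, controlled by its norm. -/
  decomposition : ∀ μ, ∃ p : Fin 4 → Measure S, (∀ k, IsFiniteMeasure (p k)) ∧
    (∀ k, (p k).real Set.univ ≤ ‖μ‖) ∧ ∀ g, J μ g = ∑ k : Fin 4, Complex.I ^ (k : ℕ) * ∫ x, g x ∂p k
  continuous_average : ∀ μ g, Continuous fun y => J μ (rightTranslate y g)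
  exists_convolution : ∀ μ ν, ∃ ρ, ∀ g h : S →ᵇ ℂ,
    (∀ y, h y = J μ (rightTranslate y g)) → J ρ g = J ν h

namespace IsConvolutionModel

variable {J : M →L[ℂ] StrongDual ℂ (S →ᵇ ℂ)}

theorem norm_apply_le (h : IsConvolutionModel J) (μ : M) (g : S →ᵇ ℂ) : ‖J μ g‖ ≤ ‖μ‖ * ‖g‖ :=
  ((J μ).le_opNorm g).trans (by gcongr; exact h.norm_le μ)

theorem norm_le_of_forall (h : IsConvolutionModel J) {μ : M} {C : ℝ}
    (hC : ∀ f : S →ᵇ ℂ, ‖f‖ ≤ 1 → ‖J μ f‖ ≤ C) : ‖μ‖ ≤ C := by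
  refine le_of_forall_pos_le_add fun ε hε => ?_
  obtain ⟨f, -, hf1, hf⟩ := h.norming μ ε hε
  linarith [hC f hf1]

theorem ext (h : IsConvolutionModel J) {μ ν : M} (hμν : ∀ g, J μ g = J ν g) : μ = ν := by
  rw [← sub_eq_zero, ← norm_le_zero_iff]
  refine h.norm_le_of_forall fun f _ => ?_
  simp [hμν f]

/-- The function `y ↦ ∫ g (x y) dμ(x)`. -/
noncomputable def average (h : IsConvolutionModel J) (μ : M) (g : S →ᵇ ℂ) : S →ᵇ ℂ :=
  BoundedContinuousFunction.ofNormedAddCommGroup (fun y => J μ (rightTranslate y g))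
    (h.continuous_average μ g) (‖μ‖ * ‖g‖) fun y => (h.norm_apply_le μ _).trans (by
      gcongr; exact norm_rightTranslate_le y g)

@[simp]
theorem average_apply (h : IsConvolutionModel J) (μ : M) (g : S →ᵇ ℂ) (y : S) :
    h.average μ g y = J μ (rightTranslate y g) := rfl

theorem norm_average_le (h : IsConvolutionModel J) (μ : M) (g : S →ᵇ ℂ) :
    ‖h.average μ g‖ ≤ ‖μ‖ * ‖g‖ :=
  BoundedContinuousFunction.norm_ofNormedAddCommGroup_le _ (by positivity) _

/-- The convolution product, as a function. -/
noncomputable def mulAux (h : IsConvolutionModel J) (μ ν : M) : M :=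
  (h.exists_convolution μ ν).choose

theorem apply_mulAux (h : IsConvolutionModel J) (μ ν : M) (g : S →ᵇ ℂ) :
    J (h.mulAux μ ν) g = J ν (h.average μ g) :=
  (h.exists_convolution μ ν).choose_spec g _ fun _ => rfl

theorem average_add (h : IsConvolutionModel J) (μ μ' : M) (g : S →ᵇ ℂ) :
    h.average (μ + μ') g = h.average μ g + h.average μ' g := by
  ext y; simp

theorem average_smul (h : IsConvolutionModel J) (c : ℂ) (μ : M) (g : S →ᵇ ℂ) :
    h.average (c • μ) g = c • h.average μ g := by
  ext y; simp

theorem norm_mulAux_le (h : IsConvolutionModel J) (μ ν : M) :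
    ‖h.mulAux μ ν‖ ≤ ‖μ‖ * ‖ν‖ := by
  refine h.norm_le_of_forall fun f hf => ?_
  rw [h.apply_mulAux, mul_comm]
  refine (h.norm_apply_le ν _).trans ?_
  gcongr
  exact (h.norm_average_le μ f).trans (mul_le_of_le_one_right (norm_nonneg μ) hf)

/-- The convolution product, as a bounded bilinear map. -/
noncomputable def mul (h : IsConvolutionModel J) : M →L[ℂ] M →L[ℂ] M :=
  LinearMap.mkContinuous₂
    (LinearMap.mk₂ ℂ h.mulAux
      (fun μ μ' ν => h.ext fun g => by simp [apply_mulAux, average_add])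
      (fun c μ ν => h.ext fun g => by simp [apply_mulAux, average_smul])
      (fun μ ν ν' => h.ext fun g => by simp [apply_mulAux])
      (fun c μ ν => h.ext fun g => by simp [apply_mulAux])) 1
    fun μ ν => by simpa using h.norm_mulAux_le μ ν

theorem apply_mul (h : IsConvolutionModel J) (μ ν : M) (g : S →ᵇ ℂ) :
    J (h.mul μ ν) g = J ν (h.average μ g) := h.apply_mulAux μ ν g

theorem isBanachAlgebra [CompleteSpace M] (h : IsConvolutionModel J) : IsBanachAlgebra h.mul where
  complete := inferInstance
  norm_mul_le := h.norm_mulAux_le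
  assoc a b c := by
    refine h.ext fun g => ?_
    simp only [apply_mul]
    congr 1
    ext z
    simp only [average_apply, apply_mul]
    congr 1
    ext y
    simp only [average_apply, rightTranslate_apply, rightTranslate_rightTranslate]

/-- The heart of the matter: a weakly almost periodic function on `S` defines a weakly almost
periodic functional on the convolution algebra. The pairing of `μ` and `ν` is the integral against
`ν` of the functional `J μ` evaluated along the orbit of `f`, whose weak closure is compact, so
the double limit criterion follows from `exists_iteratedLimits_integral`. -/
theorem flip_apply_mem_WAP [OpensMeasurableSpace S] (h : IsConvolutionModel J) {f : S →ᵇ ℂ}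
    (hf : f ∈ wap S) : J.flip f ∈ WAP h.mul := by
  let T : M →L[ℂ] StrongDual ℂ M := (ContinuousLinearMap.compL ℂ M M ℂ (J.flip f)).comp h.mul
  have hT : ∀ μ ν, T μ ν = J ν (h.average μ f) := fun μ ν => h.apply_mul μ ν f
  change RelWeaklyCompact {g | ∃ a : M, ‖a‖ ≤ 1 ∧ g = T a}
  refine relWeaklyCompact_of_iteratedLimits T ?_
  intro a b ha ⟨C, hb⟩ α β s t hα hαs hβ hβt
  let K : Set (WeakSpace ℂ (S →ᵇ ℂ)) :=
    closure (toWeakSpace ℂ (S →ᵇ ℂ) '' Set.range fun s : S => rightTranslate s f)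
  have : CompactSpace K := isCompact_iff_compactSpace.1 hf
  let r : S → K := fun y => ⟨toWeakSpace ℂ (S →ᵇ ℂ) (rightTranslate y f),
    subset_closure ⟨_, ⟨y, rfl⟩, rfl⟩⟩
  have hr : Continuous r := (continuous_toWeakSpace_rightTranslate hf).subtype_mk _
  let ev : StrongDual ℂ (S →ᵇ ℂ) → K → ℂ := fun Ψ k => Ψ ((toWeakSpace ℂ (S →ᵇ ℂ)).symm k.1)
  have hev : ∀ Ψ, Continuous (ev Ψ) := fun Ψ =>
    (continuous_toWeakSpace_symm_apply Ψ).comp continuous_subtype_val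
  have hJa : ∀ n, ‖J (a n)‖ ≤ 1 := fun n => (h.norm_le _).trans (ha n)
  have hbound : ∀ n k, ‖ev (J (a n)) k‖ ≤ ‖f‖ := by
    intro n k
    have hcl : IsClosed {x : WeakSpace ℂ (S →ᵇ ℂ) |
        ‖J (a n) ((toWeakSpace ℂ (S →ᵇ ℂ)).symm x)‖ ≤ ‖f‖} :=
      isClosed_le (continuous_toWeakSpace_symm_apply _).norm continuous_const
    refine closure_minimal ?_ hcl k.2
    rintro _ ⟨_, ⟨y, rfl⟩, rfl⟩
    change ‖J (a n) (rightTranslate y f)‖ ≤ ‖f‖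
    calc _ ≤ ‖J (a n)‖ * ‖rightTranslate y f‖ := (J (a n)).le_opNorm _
      _ ≤ 1 * ‖f‖ := by gcongr; exacts [hJa n, norm_rightTranslate_le y f]
      _ = ‖f‖ := one_mul _
  have hV : ∀ V : Ultrafilter ℕ, ∃ g : K → ℂ, Continuous g ∧
      ∀ k, Tendsto (fun n => ev (J (a n)) k) V (𝓝 (g k)) := by
    intro V
    obtain ⟨Ψ₀, hΨ₀⟩ := exists_ultrafilter_limit hJa V
    exact ⟨ev Ψ₀, hev Ψ₀, fun k => hΨ₀ _⟩
  choose p hpfin hpmass hp using fun n => h.decomposition (b n)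
  have hTp : ∀ n m, T (a n) (b m) =
      ∑ k : Fin 4, Complex.I ^ (k : ℕ) * ∫ y, ev (J (a n)) (r y) ∂p m k := by
    intro n m
    rw [hT, hp]; rfl
  let U : Ultrafilter ℕ := hyperfilter ℕ
  have hU : (U : Filter ℕ) ≤ atTop := Nat.hyperfilter_le_atTop
  choose α' β' s' h1 h2 h3 h4 using fun k : Fin 4 =>
    exists_iteratedLimits_integral (fun n => hev (J (a n))) hbound hV U hr (fun m => p m k)
      fun m => (hpmass m k).trans (hb m)
  have e1 : ∀ m, α m = ∑ k : Fin 4, Complex.I ^ (k : ℕ) * β' k m := fun m =>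
    tendsto_nhds_unique ((hα m).mono_left hU) (by
      simp only [hTp]
      exact tendsto_finsetSum _ fun k _ => (h3 k m).const_mul _)
  have e2 : ∀ n, β n = ∑ k : Fin 4, Complex.I ^ (k : ℕ) * α' k n := fun n =>
    tendsto_nhds_unique ((hβ n).mono_left hU) (by
      simp only [hTp]
      exact tendsto_finsetSum _ fun k _ => (h1 k n).const_mul _)
  have e3 : s = ∑ k : Fin 4, Complex.I ^ (k : ℕ) * s' k :=
    tendsto_nhds_unique (hαs.mono_left hU) (by
      rw [funext e1]
      exact tendsto_finsetSum _ fun k _ => (h4 k).const_mul _)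
  have e4 : t = ∑ k : Fin 4, Complex.I ^ (k : ℕ) * s' k :=
    tendsto_nhds_unique (hβt.mono_left hU) (by
      rw [funext e2]
      exact tendsto_finsetSum _ fun k _ => (h2 k).const_mul _)
  rw [e3, e4]

theorem norm_flip_apply_le (h : IsConvolutionModel J) (f : S →ᵇ ℂ) : ‖J.flip f‖ ≤ ‖f‖ :=
  ContinuousLinearMap.opNorm_le_bound _ (norm_nonneg f) fun μ => by
    rw [mul_comm]
    exact h.norm_apply_le μ f

theorem isWAPAlgebra [OpensMeasurableSpace S] [CompleteSpace M] (h : IsConvolutionModel J) :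
    IsWAPAlgebra h.mul := by
  refine ⟨h.isBanachAlgebra, 1 / 2, by norm_num, fun a ha => ?_⟩
  obtain ⟨f, hf, hf1, hle⟩ := h.norming a (1 / 2) (by norm_num)
  have h1 := norm_apply_le_norm_toDualWAP h.mul (h.flip_apply_mem_WAP hf)
    ((h.norm_flip_apply_le f).trans hf1) a
  rw [ContinuousLinearMap.flip_apply] at h1
  linarith

end IsConvolutionModel

end Model

/-! ### Integration against complex measures -/

section Integration

variable {X : Type*} {mX : MeasurableSpace X}

theorem integral_const_smul_complexMeasure {μ : ComplexMeasure X} {f : X → ℂ}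
    (hf : μ.Integrable f) (c : ℂ) :
    (c • μ).integral f (ContinuousLinearMap.mul ℝ ℂ) =
      c * μ.integral f (ContinuousLinearMap.mul ℝ ℂ) := by
  have hvar : (c • μ).variation = ‖c‖ₑ • μ.variation := by
    rw [VectorMeasure.variation_smul]; rfl
  have hT : DominatedFinMeasAdditive μ.variation
      ((c • μ).transpose (ContinuousLinearMap.mul ℝ ℂ))
      (‖c‖ₑ.toReal * ‖ContinuousLinearMap.mul ℝ ℂ‖) := by
    refine DominatedFinMeasAdditive.of_measure_le_smul enorm_ne_top hvar.le
      (dominatedFinMeasAdditive_cbmApplyMeasure (c • μ) _) (ContinuousLinearMap.opNorm_nonneg _)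
  have h1 : ∀ g, μ.Integrable g →
      (c • μ).integral g (ContinuousLinearMap.mul ℝ ℂ) = setToFun μ.variation _ hT g :=
    fun g hg => (setToFun_congr_measure_of_integrable _ enorm_ne_top hvar.le hT _ g hg).symm
  rw [h1 f hf]
  refine Integrable.induction (fun g => setToFun μ.variation _ hT g =
    c * μ.integral g (ContinuousLinearMap.mul ℝ ℂ)) ?_ ?_ ?_ ?_ hf
  · intro x s hs hlt
    rw [VectorMeasure.integral_eq_setToFun, setToFun_indicator_const _ hs hlt.ne,
      setToFun_indicator_const _ hs hlt.ne]
    simp [VectorMeasure.transpose]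
    ring
  · intro g g' _ hg hg' e e'
    rw [setToFun_add hT hg hg', e, e', VectorMeasure.integral_eq_setToFun,
      VectorMeasure.integral_eq_setToFun, VectorMeasure.integral_eq_setToFun,
      setToFun_add _ hg hg', mul_add]
  · exact isClosed_eq (continuous_setToFun hT)
      (continuous_const.mul VectorMeasure.continuous_integral)
  · intro g g' hgg' _ e
    rw [← setToFun_congr_ae hT hgg', e, VectorMeasure.integral_congr_ae hgg']

/-- A finite positive measure, as a complex measure. -/
noncomputable def complexOfMeasure (p : FiniteMeasure X) : ComplexMeasure X :=
  (p : Measure X).toSignedMeasure.toComplexMeasure 0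

theorem complexOfMeasure_apply (p : FiniteMeasure X) {E : Set X} (hE : MeasurableSet E) :
    complexOfMeasure p E = ((p : Measure X).real E : ℂ) := by
  rw [complexOfMeasure, SignedMeasure.toComplexMeasure_apply,
    Measure.toSignedMeasure_apply_measurable hE]
  rfl

theorem variation_complexOfMeasure_le (p : FiniteMeasure X) :
    (complexOfMeasure p).variation ≤ p := by
  refine VectorMeasure.variation_le_of_forall_enorm_le fun E hE => ?_
  rw [complexOfMeasure_apply p hE, ← ofReal_norm, Complex.norm_real, Real.norm_eq_abs,
    abs_of_nonneg measureReal_nonneg, ofReal_measureReal]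

theorem integral_complexOfMeasure (p : FiniteMeasure X) {f : X → ℂ}
    (hf : Integrable f (p : Measure X)) :
    (complexOfMeasure p).integral f (ContinuousLinearMap.mul ℝ ℂ) = ∫ x, f x ∂(p : Measure X) := by
  have hT : DominatedFinMeasAdditive (p : Measure X)
      ((complexOfMeasure p).transpose (ContinuousLinearMap.mul ℝ ℂ))
      ‖ContinuousLinearMap.mul ℝ ℂ‖ :=
    DominatedFinMeasAdditive.of_measure_le (variation_complexOfMeasure_le p)
      (dominatedFinMeasAdditive_cbmApplyMeasure _ _) (ContinuousLinearMap.opNorm_nonneg _)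
  rw [VectorMeasure.integral_eq_setToFun, integral_eq_setToFun,
    ← setToFun_congr_measure_of_integrable 1 ENNReal.one_ne_top
      (by simpa using variation_complexOfMeasure_le p) hT _ f hf]
  refine setToFun_congr_left' _ _ (fun s hs _ => ?_) f
  ext x
  simp [VectorMeasure.transpose, complexOfMeasure_apply p hs, weightedSMul]

/-- A complex measure is a combination of its four Jordan parts. -/
theorem exists_eq_sum_complexOfMeasure (μ : ComplexMeasure X) :
    ∃ p : Fin 4 → FiniteMeasure X, (∀ k, (p k : Measure X) ≤ μ.variation) ∧
      μ = ∑ k : Fin 4, Complex.I ^ (k : ℕ) • complexOfMeasure (p k) := by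
  set a := ComplexMeasure.re μ with ha
  set b := ComplexMeasure.im μ with hb
  have hle : ∀ (s : SignedMeasure X), (∀ E, |s E| ≤ ‖μ E‖) →
      s.toJordanDecomposition.posPart ≤ μ.variation ∧
      s.toJordanDecomposition.negPart ≤ μ.variation := by
    intro s hs
    have h1 : s.totalVariation ≤ μ.variation := by
      rw [SignedMeasure.totalVariation_eq_variation]
      refine VectorMeasure.variation_le_of_forall_enorm_le fun E _ => ?_
      refine le_trans ?_ (VectorMeasure.enorm_measure_le_variation μ E)
      rw [← ofReal_norm, ← ofReal_norm, Real.norm_eq_abs]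
      exact ENNReal.ofReal_le_ofReal (hs E)
    exact ⟨(Measure.le_add_right le_rfl).trans h1, (Measure.le_add_left le_rfl).trans h1⟩
  have hale := hle a fun E => Complex.abs_re_le_norm (μ E)
  have hble := hle b fun E => Complex.abs_im_le_norm (μ E)
  refine ⟨![⟨a.toJordanDecomposition.posPart, inferInstance⟩,
    ⟨b.toJordanDecomposition.posPart, inferInstance⟩,
    ⟨a.toJordanDecomposition.negPart, inferInstance⟩,
    ⟨b.toJordanDecomposition.negPart, inferInstance⟩], ?_, ?_⟩
  · intro k
    fin_cases k
    exacts [hale.1, hble.1, hale.2, hble.2]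
  · have hs : ∀ (s : SignedMeasure X) (E : Set X), MeasurableSet E →
        s E = s.toJordanDecomposition.posPart.real E - s.toJordanDecomposition.negPart.real E := by
      intro s E hE
      conv_lhs => rw [← s.toSignedMeasure_toJordanDecomposition]
      exact Measure.toSignedMeasure_sub_apply hE
    ext E hE
    rw [Fin.sum_univ_four]
    simp only [add_apply, smul_apply, complexOfMeasure_apply _ hE]
    have e1 : (μ E).re = _ := hs a E hE
    have e2 : (μ E).im = _ := hs b E hE
    rw [← Complex.re_add_im (μ E), e1, e2]
    simp [pow_succ]
    ring

end Integration

/-! ### The Banach space of regular complex measures -/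

section Series

variable {X : Type*} {mX : MeasurableSpace X}

/-- The complex measure `∑ μ n`, for an absolutely convergent series. -/
noncomputable def sumComplexMeasure (μ : ℕ → ComplexMeasure X)
    (hμ : Summable fun n => (μ n).variation.real Set.univ) : ComplexMeasure X where
  measureOf' E := ∑' n, μ n E
  empty' := by simp
  not_measurable' E hE := by simp [VectorMeasure.not_measurable _ hE]
  m_iUnion' f hf hdisj := by
    have hbound : ∀ n E, ‖μ n E‖ ≤ (μ n).variation.real E := fun n E =>
      VectorMeasure.norm_measure_le_variation (measure_ne_top _ _)
    have hsum : ∀ n, HasSum (fun i => (μ n).variation.real (f i))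
        ((μ n).variation.real (⋃ i, f i)) := fun n => by
      have h1 := measure_iUnion (μ := (μ n).variation) hdisj hf
      have h2 : HasSum (fun i => (μ n).variation.real (f i)) _ :=
        ENNReal.hasSum_toReal (h1 ▸ measure_ne_top _ _)
      rwa [← ENNReal.tsum_toReal_eq (fun i => measure_ne_top _ _), ← h1] at h2
    have hF : Summable fun x : ℕ × ℕ => μ x.1 (f x.2) := by
      refine Summable.of_norm_bounded (g := fun x : ℕ × ℕ => (μ x.1).variation.real (f x.2)) ?_
        fun x => hbound _ _
      refine (summable_prod_of_nonneg fun _ => measureReal_nonneg).2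
        ⟨fun n => (hsum n).summable, ?_⟩
      refine hμ.of_nonneg_of_le (fun n => tsum_nonneg fun _ => measureReal_nonneg) fun n => ?_
      rw [(hsum n).tsum_eq]
      exact measureReal_mono (Set.subset_univ _)
    have h1 : ∑' n, μ n (⋃ i, f i) = ∑' x : ℕ × ℕ, μ x.1 (f x.2) := by
      rw [hF.tsum_prod]
      exact tsum_congr fun n => ((μ n).m_iUnion hf hdisj).tsum_eq.symm
    have h2 := (hF.prod_symm).hasSum.prod_fiberwise fun i =>
      (hF.prod_symm.prod_factor i).hasSum
    rw [h1, ← (Equiv.prodComm ℕ ℕ).tsum_eq]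
    exact h2

theorem sumComplexMeasure_apply (μ : ℕ → ComplexMeasure X)
    (hμ : Summable fun n => (μ n).variation.real Set.univ) (E : Set X) :
    sumComplexMeasure μ hμ E = ∑' n, μ n E := rfl

end Series

section MeasureSpace

variable {S : Type*} [MeasurableSpace S] [TopologicalSpace S] [T2Space S] [BorelSpace S]

theorem MeasureAlgebra.norm_def (μ : MeasureAlgebra S) : ‖μ‖ = μ.1.variation.real Set.univ := rfl

theorem norm_cintegral_le (μ : MeasureAlgebra S) (f : S → ℂ) :
    ‖cintegral μ f‖ ≤ ∫ x, ‖f x‖ ∂μ.1.variation :=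
  VectorMeasure.norm_integral_le_integral_norm.trans
    (mul_le_of_le_one_left (integral_nonneg fun _ => norm_nonneg _)
      (ContinuousLinearMap.opNorm_mul_le ℝ ℂ))

theorem cintegral_const_mul (μ : MeasureAlgebra S) (c : ℂ) (f : S → ℂ) :
    cintegral μ (fun x => c * f x) = c * cintegral μ f :=
  setToFun_smul _ (fun c E x => by simp [VectorMeasure.transpose, mul_left_comm]) c f

theorem norm_cintegral_le_mul_norm (μ : MeasureAlgebra S) (g : S →ᵇ ℂ) :
    ‖cintegral μ g‖ ≤ ‖μ‖ * ‖g‖ := by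
  refine (norm_cintegral_le μ g).trans ?_
  rw [MeasureAlgebra.norm_def]
  refine (integral_mono_of_nonneg (.of_forall fun _ => norm_nonneg _) (integrable_const ‖g‖)
    (.of_forall fun x => g.norm_coe_le_norm x)).trans ?_
  rw [integral_const, smul_eq_mul]

/-- The pairing `(μ, g) ↦ ∫ g dμ` with the bounded continuous functions. -/
noncomputable def pairing : MeasureAlgebra S →L[ℂ] StrongDual ℂ (S →ᵇ ℂ) :=
  LinearMap.mkContinuous₂
    (LinearMap.mk₂ ℂ (fun (μ : MeasureAlgebra S) (g : S →ᵇ ℂ) => cintegral μ g)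
      (fun μ ν g => VectorMeasure.integral_add_vectorMeasure (g.integrable _) (g.integrable _))
      (fun c μ g => integral_const_smul_complexMeasure (g.integrable _) c)
      (fun μ g g' => VectorMeasure.integral_add (g.integrable _) (g'.integrable _))
      (fun c μ g => cintegral_const_mul μ c g)) 1
    fun μ g => by
      rw [one_mul]
      exact norm_cintegral_le_mul_norm μ g

theorem norm_pairing_le (μ : MeasureAlgebra S) : ‖pairing μ‖ ≤ ‖μ‖ :=
  ContinuousLinearMap.opNorm_le_bound _ (norm_nonneg μ) (norm_cintegral_le_mul_norm μ)

/-- A finite regular positive measure, as an element of `M_b(S)`. -/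
noncomputable def MeasureAlgebra.ofMeasure (p : FiniteMeasure S) (hp : (p : Measure S).Regular) :
    MeasureAlgebra S :=
  ⟨complexOfMeasure p, regular_of_le (variation_complexOfMeasure_le p)⟩

theorem pairing_ofMeasure (p : FiniteMeasure S) (hp : (p : Measure S).Regular) (g : S →ᵇ ℂ) :
    pairing (MeasureAlgebra.ofMeasure p hp) g = ∫ x, g x ∂(p : Measure S) :=
  integral_complexOfMeasure p (g.integrable _)

theorem exists_eq_sum_ofMeasure (μ : MeasureAlgebra S) :
    ∃ (p : Fin 4 → FiniteMeasure S) (hp : ∀ k, (p k : Measure S).Regular),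
      (∀ k, (p k : Measure S).real Set.univ ≤ ‖μ‖) ∧
      μ = ∑ k : Fin 4, Complex.I ^ (k : ℕ) • MeasureAlgebra.ofMeasure (p k) (hp k) := by
  obtain ⟨p, hp, hsum⟩ := exists_eq_sum_complexOfMeasure μ.1
  have : μ.1.variation.Regular := μ.2
  refine ⟨p, fun k => regular_of_le (hp k), fun k => ?_, Subtype.ext ?_⟩
  · exact ENNReal.toReal_mono (measure_ne_top _ _) (hp k _)
  · refine hsum.trans ?_
    simp [MeasureAlgebra.ofMeasure]

theorem pairing_eq_sum {ν : MeasureAlgebra S} {q : Fin 4 → FiniteMeasure S}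
    {hq : ∀ k, (q k : Measure S).Regular}
    (hν : ν = ∑ k : Fin 4, Complex.I ^ (k : ℕ) • MeasureAlgebra.ofMeasure (q k) (hq k))
    (g : S →ᵇ ℂ) :
    pairing ν g = ∑ k : Fin 4, Complex.I ^ (k : ℕ) * ∫ x, g x ∂(q k : Measure S) := by
  rw [hν]
  simp [pairing_ofMeasure]

/-- Indicator functions are approximated in `L¹` by compactly supported continuous functions. The
space is not assumed to be normal, only locally compact. -/
theorem exists_hasCompactSupport_integral_indicator_sub_le [LocallyCompactSpace S] (p : Measure S)
    [IsFiniteMeasure p] [p.Regular] {E : Set S} (hE : MeasurableSet E) {ε : ℝ} (hε : 0 < ε) :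
    ∃ f : S → ℝ, Continuous f ∧ HasCompactSupport f ∧
      ∫ x, ‖E.indicator (fun _ => (1 : ℝ)) x - f x‖ ∂p ≤ ε := by
  have hε2 : ENNReal.ofReal (ε / 2) ≠ 0 := by simpa using hε
  obtain ⟨K, hKE, hK, hEK⟩ := hE.exists_isCompact_sdiff_lt (μ := p) (measure_ne_top _ _) hε2
  obtain ⟨V, hKV, hV, -, hVK⟩ := hK.measurableSet.exists_isOpen_sdiff_lt (μ := p)
    (measure_ne_top _ _) hε2
  obtain ⟨f, hfK, hfV, hfs, hf01⟩ := exists_continuous_one_zero_of_isCompact hK hV.isClosed_compl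
    (Set.disjoint_compl_right_iff_subset.2 hKV)
  refine ⟨f, f.continuous, hfs, ?_⟩
  have hfi : Integrable f p := f.continuous.integrable_of_hasCompactSupport hfs
  have hmeas : MeasurableSet ((E \ K) ∪ (V \ K)) :=
    (hE.diff hK.measurableSet).union (hV.measurableSet.diff hK.measurableSet)
  have hle : ∀ x, ‖E.indicator (fun _ => (1 : ℝ)) x - f x‖ ≤
      ((E \ K) ∪ (V \ K)).indicator (fun _ => (1 : ℝ)) x := by
    intro x
    have h01 := hf01 x
    by_cases hxK : x ∈ K
    · have h1 : f x = 1 := hfK hxK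
      simp [h1, hxK, hKE hxK]
    by_cases hxV : x ∈ V
    · have hmem : x ∈ (E \ K) ∪ (V \ K) := Or.inr ⟨hxV, hxK⟩
      rw [Set.indicator_of_mem hmem, Real.norm_eq_abs, abs_le]
      by_cases hxE : x ∈ E
      · rw [Set.indicator_of_mem hxE]; constructor <;> linarith [h01.1, h01.2]
      · rw [Set.indicator_of_notMem hxE]; constructor <;> linarith [h01.1, h01.2]
    · have h1 : f x = 0 := hfV hxV
      by_cases hxE : x ∈ E <;> simp [h1, hxE, hxK, hxV]
  calc ∫ x, ‖E.indicator (fun _ => (1 : ℝ)) x - f x‖ ∂p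
      ≤ ∫ x, ((E \ K) ∪ (V \ K)).indicator (fun _ => (1 : ℝ)) x ∂p :=
        integral_mono (((integrable_const _).indicator hE).sub hfi).norm
          ((integrable_const _).indicator hmeas) hle
    _ = p.real ((E \ K) ∪ (V \ K)) := integral_indicator_one hmeas
    _ ≤ p.real (E \ K) + p.real (V \ K) := measureReal_union_le _ _
    _ ≤ ε / 2 + ε / 2 := add_le_add
        (ENNReal.toReal_le_of_le_ofReal (by positivity) hEK.le)
        (ENNReal.toReal_le_of_le_ofReal (by positivity) hVK.le)
    _ = ε := add_halves ε

/-- The norm of a regular complex measure is recovered from the continuous functions vanishing at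
infinity: a step function adapted to a near-optimal partition is approximated in `L¹` by a
compactly supported function, which is then cut off to have values in the unit disc. -/
theorem exists_norm_sub_le_norm_pairing [LocallyCompactSpace S] (μ : MeasureAlgebra S) {ε : ℝ}
    (hε : 0 < ε) : ∃ f : C₀(S, ℂ), ‖f.toBCF‖ ≤ 1 ∧ ‖μ‖ - ε ≤ ‖pairing μ f.toBCF‖ := by
  classical
  have hreg : μ.1.variation.Regular := μ.2
  obtain ⟨P, -, hdisj, hmeas, hP⟩ := μ.1.exists_variation_le_add' MeasurableSet.univ
    (ε := ENNReal.ofReal (ε / 3)) (by simpa using hε) (measure_ne_top _ _)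
  have hP' : ‖μ‖ ≤ ∑ E ∈ P, ‖μ.1 E‖ + ε / 3 := by
    have htop : ∑ E ∈ P, ‖μ.1 E‖ₑ ≠ ∞ := ENNReal.sum_ne_top.2 fun E _ => enorm_ne_top
    have h1 := ENNReal.toReal_mono (by finiteness) hP
    rw [ENNReal.toReal_add htop (by finiteness), ENNReal.toReal_ofReal (by positivity),
      ENNReal.toReal_sum fun E _ => enorm_ne_top] at h1
    simp only [toReal_enorm] at h1
    exact h1
  let c : Set S → ℂ := fun E => (starRingEnd ℂ) (μ.1 E) / ‖μ.1 E‖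
  have hc1 : ∀ E, ‖c E‖ ≤ 1 := fun E => by
    simp only [c, norm_div, RCLike.norm_conj, Complex.norm_real, norm_norm]
    exact div_self_le_one _
  have hcμ : ∀ E, c E * μ.1 E = ‖μ.1 E‖ := fun E => by
    rcases eq_or_ne (μ.1 E) 0 with h0 | h0
    · simp [c, h0]
    · have h2 : (‖μ.1 E‖ : ℂ) ≠ 0 := by simpa using h0
      simp only [c]
      rw [div_mul_eq_mul_div, mul_comm, Complex.mul_conj, Complex.normSq_eq_norm_sq]
      push_cast
      field_simp
  let σ : S → ℂ := fun x => ∑ E ∈ P, E.indicator (fun _ => c E) x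
  have hint : ∀ E ∈ P, Integrable (E.indicator fun _ => c E) μ.1.variation := fun E hE =>
    (integrable_const _).indicator (hmeas E hE)
  have hσint : Integrable σ μ.1.variation := integrable_finsetSum P hint
  have hσ1 : ∀ x, ‖σ x‖ ≤ 1 := by
    intro x
    by_cases hx : ∃ E ∈ P, x ∈ E
    · obtain ⟨E, hE, hxE⟩ := hx
      have : σ x = c E := by
        simp only [σ]
        rw [Finset.sum_eq_single_of_mem E hE, Set.indicator_of_mem hxE]
        intro F hF hFE
        exact Set.indicator_of_notMem (fun hxF =>
          Set.disjoint_left.1 (hdisj hF hE hFE) hxF hxE) _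
      rw [this]; exact hc1 E
    · have : σ x = 0 := Finset.sum_eq_zero fun E hE =>
        Set.indicator_of_notMem (fun hxE => hx ⟨E, hE, hxE⟩) _
      simp [this]
  have hσμ : cintegral μ σ = ((∑ E ∈ P, ‖μ.1 E‖ : ℝ) : ℂ) := by
    have h1 : cintegral μ σ = ∑ E ∈ P, cintegral μ (E.indicator fun _ => c E) :=
      VectorMeasure.integral_finsetSum P hint
    rw [h1]
    push_cast
    refine Finset.sum_congr rfl fun E hE => ?_
    rw [← hcμ E, cintegral, VectorMeasure.integral_eq_setToFun,
      setToFun_indicator_const _ (hmeas E hE) (measure_ne_top _ _)]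
    simp [VectorMeasure.transpose, mul_comm]
  -- approximate every indicator function, with an error that is harmless after summation
  have hη : 0 < ε / 3 / (P.card + 1) := by positivity
  choose! g₀ hg₀c hg₀supp hg₀ using fun E hE =>
    exists_hasCompactSupport_integral_indicator_sub_le μ.1.variation (hmeas E hE) hη
  let g : S → ℂ := fun x => ∑ E ∈ P, c E * (g₀ E x : ℂ)
  have hgc : Continuous g := continuous_finsetSum _ fun E hE =>
    continuous_const.mul (Complex.continuous_ofReal.comp (hg₀c E hE))
  have hgsupp : HasCompactSupport g := by
    have h1 : IsCompact (⋃ E ∈ P, tsupport (g₀ E)) := P.isCompact_biUnion hg₀supp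
    refine HasCompactSupport.intro h1 fun x hx => Finset.sum_eq_zero fun E hE => ?_
    rw [image_eq_zero_of_notMem_tsupport fun hxE => hx (Set.mem_biUnion hE hxE)]
    simp
  have hg₀i : ∀ E ∈ P, Integrable (g₀ E) μ.1.variation := fun E hE =>
    (hg₀c E hE).integrable_of_hasCompactSupport (hg₀supp E hE)
  have hgi : Integrable g μ.1.variation := hgc.integrable_of_hasCompactSupport hgsupp
  have hone : ∀ E ∈ P, Integrable (fun x => E.indicator (fun _ => (1 : ℝ)) x - g₀ E x)
      μ.1.variation := fun E hE =>
    ((integrable_const _).indicator (hmeas E hE)).sub (hg₀i E hE)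
  have hgσ : ∫ x, ‖σ x - g x‖ ∂μ.1.variation ≤ ε / 3 := by
    calc ∫ x, ‖σ x - g x‖ ∂μ.1.variation
        ≤ ∫ x, ∑ E ∈ P, ‖E.indicator (fun _ => (1 : ℝ)) x - g₀ E x‖ ∂μ.1.variation := by
          refine integral_mono (hσint.sub hgi).norm
            (integrable_finsetSum P fun E hE => (hone E hE).norm) fun x => ?_
          simp only [σ, g, ← Finset.sum_sub_distrib]
          refine (norm_sum_le _ _).trans (Finset.sum_le_sum fun E _ => ?_)
          have h1 : E.indicator (fun _ => c E) x - c E * (g₀ E x : ℂ) =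
              c E * ((E.indicator (fun _ => (1 : ℝ)) x - g₀ E x : ℝ) : ℂ) := by
            by_cases hx : x ∈ E <;> simp [hx, mul_sub]
          rw [h1, norm_mul, Complex.norm_real]
          exact mul_le_of_le_one_left (norm_nonneg _) (hc1 E)
      _ = ∑ E ∈ P, ∫ x, ‖E.indicator (fun _ => (1 : ℝ)) x - g₀ E x‖ ∂μ.1.variation :=
          integral_finsetSum _ fun E hE => (hone E hE).norm
      _ ≤ ∑ E ∈ P, ε / 3 / (P.card + 1) := Finset.sum_le_sum hg₀
      _ ≤ ε / 3 := by
          rw [Finset.sum_const, nsmul_eq_mul, mul_div_assoc', div_le_iff₀ (by positivity)]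
          nlinarith
  -- radial truncation, which at most doubles the distance to a function with values in the disc
  let t : S → ℂ := fun x => ((max 1 ‖g x‖ : ℝ) : ℂ)⁻¹ * g x
  have hmax : ∀ x, 0 < max 1 ‖g x‖ := fun x => lt_of_lt_of_le one_pos (le_max_left _ _)
  have htc : Continuous t := by
    refine Continuous.mul (Continuous.inv₀ (by fun_prop) fun x => ?_) hgc
    exact_mod_cast (hmax x).ne'
  have htsupp : HasCompactSupport t := hgsupp.mul_left
  have ht1 : ∀ x, ‖t x‖ ≤ 1 := fun x => by
    simp only [t, norm_mul, norm_inv, Complex.norm_real, Real.norm_eq_abs, abs_of_pos (hmax x)]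
    rw [inv_mul_le_iff₀ (hmax x), mul_one]
    exact le_max_right _ _
  have htg : ∀ x, ‖σ x - t x‖ ≤ 2 * ‖σ x - g x‖ := fun x => by
    have h1 : ‖g x - t x‖ ≤ ‖σ x - g x‖ := by
      have h2 : g x - t x = ((1 - (max 1 ‖g x‖)⁻¹ : ℝ) : ℂ) * g x := by
        simp only [t]; push_cast; ring
      have h3 : 0 ≤ 1 - (max 1 ‖g x‖)⁻¹ := by
        rw [sub_nonneg]; exact inv_le_one_of_one_le₀ (le_max_left _ _)
      rw [h2, norm_mul, Complex.norm_real, Real.norm_eq_abs, abs_of_nonneg h3]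
      rcases le_total ‖g x‖ 1 with h4 | h4
      · rw [max_eq_left h4]; simp
      · rw [max_eq_right h4, sub_mul, one_mul, inv_mul_cancel₀ (by positivity)]
        have h5 := norm_sub_norm_le (g x) (σ x)
        rw [norm_sub_rev] at h5
        linarith [hσ1 x]
    calc ‖σ x - t x‖ ≤ ‖σ x - g x‖ + ‖g x - t x‖ := norm_sub_le_norm_sub_add_norm_sub _ _ _
      _ ≤ _ := by linarith
  let f : C₀(S, ℂ) := ⟨⟨t, htc⟩, by
    rw [← coclosedCompact_eq_cocompact]
    exact tendsto_const_nhds.congr' (hasCompactSupport_iff_eventuallyEq.1 htsupp).symm⟩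
  refine ⟨f, (BoundedContinuousFunction.norm_le zero_le_one).2 ht1, ?_⟩
  have hft : pairing μ f.toBCF = cintegral μ t := rfl
  have hti : Integrable t μ.1.variation := f.toBCF.integrable _
  have hdiff : ‖cintegral μ σ - cintegral μ t‖ ≤ 2 * (ε / 3) := by
    have h1 : cintegral μ σ - cintegral μ t = cintegral μ (fun x => σ x - t x) :=
      (VectorMeasure.integral_fun_sub hσint hti).symm
    rw [h1]
    refine (norm_cintegral_le _ _).trans ?_
    calc ∫ x, ‖σ x - t x‖ ∂μ.1.variation
        ≤ ∫ x, 2 * ‖σ x - g x‖ ∂μ.1.variation :=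
          integral_mono (hσint.sub hti).norm ((hσint.sub hgi).norm.const_mul 2) htg
      _ = 2 * ∫ x, ‖σ x - g x‖ ∂μ.1.variation := integral_const_mul _ _
      _ ≤ _ := by gcongr
  have hσn : ‖cintegral μ σ‖ = ∑ E ∈ P, ‖μ.1 E‖ := by
    rw [hσμ, Complex.norm_real, Real.norm_eq_abs,
      abs_of_nonneg (Finset.sum_nonneg fun _ _ => norm_nonneg _)]
  have h5 := norm_sub_norm_le (cintegral μ σ) (cintegral μ t)
  rw [hft]
  linarith

/-- An absolutely convergent series of regular complex measures converges setwise, and its sum is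
regular since its variation is dominated by the sum of the variations. -/
instance : CompleteSpace (MeasureAlgebra S) := by
  refine NormedAddCommGroup.completeSpace_of_summable_imp_tendsto fun u hu => ?_
  have hu' : Summable fun n => (u n).1.variation.real Set.univ := hu
  have hsumm : ∀ E, Summable fun n => (u n).1 E := fun E =>
    hu'.of_norm_bounded fun n =>
      (VectorMeasure.norm_measure_le_variation (measure_ne_top _ _)).trans
        (measureReal_mono (Set.subset_univ _))
  have hfin : ∀ N : ℕ, Measure.sum (fun n => (u (n + N)).1.variation) Set.univ =
      ENNReal.ofReal (∑' n, ‖u (n + N)‖) := fun N => by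
    rw [Measure.sum_apply _ MeasurableSet.univ,
      ENNReal.ofReal_tsum_of_nonneg (fun _ => norm_nonneg _) ((summable_nat_add_iff N).2 hu)]
    exact tsum_congr fun n => (ofReal_measureReal (measure_ne_top _ _)).symm
  -- the variation of a tail of the series is at most the sum of the variations
  have htail : ∀ N : ℕ, (sumComplexMeasure (fun n => (u n).1) hu' -
      ∑ n ∈ Finset.range N, (u n).1).variation ≤
        Measure.sum fun n => (u (n + N)).1.variation := by
    intro N
    refine VectorMeasure.variation_le_of_forall_enorm_le fun E hE => ?_
    have h1 : (sumComplexMeasure (fun n => (u n).1) hu' - ∑ n ∈ Finset.range N, (u n).1) E =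
        ∑' n, (u (n + N)).1 E := by
      have h2 := (hsumm E).sum_add_tsum_nat_add N
      have h3 : (∑ n ∈ Finset.range N, (u n).1) E = ∑ n ∈ Finset.range N, (u n).1 E :=
        by rw [FunLike.coe_sum, Finset.sum_apply]
      rw [sub_apply, sumComplexMeasure_apply, h3, ← h2]
      ring
    rw [h1, Measure.sum_apply _ hE]
    refine (enorm_tsum_le_tsum_enorm).trans (ENNReal.tsum_le_tsum fun n =>
      VectorMeasure.enorm_measure_le_variation _ _)
  have hreg : (sumComplexMeasure (fun n => (u n).1) hu').variation.Regular := by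
    have : IsFiniteMeasure (Measure.sum fun n => (u (n + 0)).1.variation) :=
      ⟨by rw [hfin]; exact ENNReal.ofReal_lt_top⟩
    have : ∀ n, (u (n + 0)).1.variation.InnerRegular := fun n => by
      have : (u (n + 0)).1.variation.Regular := (u (n + 0)).2
      infer_instance
    have : (Measure.sum fun n => (u (n + 0)).1.variation).Regular := inferInstance
    exact regular_of_le (by simpa using htail 0)
  refine ⟨⟨_, hreg⟩, tendsto_iff_norm_sub_tendsto_zero.2 ?_⟩
  refine squeeze_zero (fun _ => norm_nonneg _) (fun N => ?_)
    (tendsto_sum_nat_add fun n => ‖u n‖)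
  rw [norm_sub_rev, MeasureAlgebra.norm_def]
  have h1 : ((⟨_, hreg⟩ : MeasureAlgebra S) - ∑ n ∈ Finset.range N, u n).1 =
      sumComplexMeasure (fun n => (u n).1) hu' - ∑ n ∈ Finset.range N, (u n).1 := by
    simp
  rw [h1]
  refine ENNReal.toReal_le_of_le_ofReal (tsum_nonneg fun _ => norm_nonneg _) ?_
  rw [← hfin N]
  exact htail N _

end MeasureSpace

/-! ### Convolution of regular measures -/

section Convolution

open CompactlySupported

section Cutoff

variable {X : Type*} [TopologicalSpace X]

/-- The product of a compactly supported and a bounded continuous function. -/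
def cutoff (h : C_c(X, ℝ)) (g : X →ᵇ ℝ) : C_c(X, ℝ) :=
  ⟨⟨fun x => h x * g x, h.continuous.mul g.continuous⟩, h.hasCompactSupport.mul_right⟩

theorem norm_sub_cutoff_le {h : C_c(X, ℝ)} (hh : ∀ x, h x ∈ Set.Icc 0 1) (g : X →ᵇ ℝ) (x : X) :
    ‖g x - cutoff h g x‖ ≤ ‖g‖ * (1 - h x) := by
  have h1 : g x - cutoff h g x = g x * (1 - h x) := by
    change g x - h x * g x = _
    ring
  rw [h1, norm_mul, Real.norm_of_nonneg (sub_nonneg.2 (hh x).2)]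
  exact mul_le_mul_of_nonneg_right (g.norm_coe_le_norm x) (sub_nonneg.2 (hh x).2)

end Cutoff

theorem norm_integral_comp_mul_right_le {S : Type*} [MeasurableSpace S] [TopologicalSpace S]
    [Mul S] (p : Measure S) [IsFiniteMeasure p] (g : S →ᵇ ℝ) (y : S) :
    ‖∫ x, g (x * y) ∂p‖ ≤ ‖g‖ * p.real Set.univ :=
  norm_integral_le_of_norm_le_const (.of_forall fun _ => g.norm_coe_le_norm _)

theorem integrable_comp_mul_right {S : Type*} [MeasurableSpace S] [TopologicalSpace S]
    [BorelSpace S] [Semigroup S] [SeparatelyContinuousMul S] (p : Measure S) [IsFiniteMeasure p]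
    (g : S →ᵇ ℝ) (y : S) : Integrable (fun x => g (x * y)) p :=
  (g.compContinuous ⟨fun t => t * y, continuous_mul_const y⟩).integrable p

theorem integrable_compactlySupported_comp_mul_right {S : Type*} [MeasurableSpace S]
    [TopologicalSpace S] [BorelSpace S] [Semigroup S] [SeparatelyContinuousMul S] (p : Measure S)
    [IsFiniteMeasure p] (f : C_c(S, ℝ)) (y : S) : Integrable (fun x => f (x * y)) p :=
  integrable_comp_mul_right p f.toBoundedContinuousFunction y

theorem norm_integral_sub_integral_cutoff_le {S : Type*} [MeasurableSpace S] [TopologicalSpace S]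
    [BorelSpace S] [Semigroup S] [SeparatelyContinuousMul S] (p : Measure S) [IsFiniteMeasure p]
    {h : C_c(S, ℝ)} (hh : ∀ x, h x ∈ Set.Icc 0 1) (g : S →ᵇ ℝ) (y : S) :
    ‖∫ x, g (x * y) ∂p - ∫ x, cutoff h g (x * y) ∂p‖ ≤ ‖g‖ * ∫ x, (1 - h (x * y)) ∂p := by
  rw [← integral_sub (integrable_comp_mul_right p g y)
    (integrable_compactlySupported_comp_mul_right p (cutoff h g) y),
    ← integral_const_mul]
  exact norm_integral_le_of_norm_le (((integrable_const _).sub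
    (integrable_compactlySupported_comp_mul_right p h y)).const_mul _)
    (.of_forall fun x => norm_sub_cutoff_le hh g _)

variable {S : Type*} [MeasurableSpace S] [TopologicalSpace S] [T2Space S] [BorelSpace S]
  [Semigroup S] [SeparatelyContinuousMul S]

/-- For compactly supported `f` this is the weak continuity of translation, applied to the
functional `∫ · dp`; no joint continuity of the multiplication is available. -/
theorem continuous_integral_comp_mul_right_of_hasCompactSupport
    (H : ∀ f : C₀(S, ℂ), f.toBCF ∈ wap S) (p : Measure S) [IsFiniteMeasure p] [hp : p.Regular]
    (f : C_c(S, ℝ)) : Continuous fun y => ∫ x, f (x * y) ∂p := by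
  have hsupp : HasCompactSupport fun x => (f x : ℂ) :=
    f.hasCompactSupport.comp_left Complex.ofReal_zero
  let F : C₀(S, ℂ) := ⟨⟨fun x => (f x : ℂ), Complex.continuous_ofReal.comp f.continuous⟩, by
    rw [← coclosedCompact_eq_cocompact]
    exact tendsto_const_nhds.congr' (hasCompactSupport_iff_eventuallyEq.1 hsupp).symm⟩
  let P : FiniteMeasure S := ⟨p, inferInstance⟩
  have hP : (P : Measure S).Regular := hp
  have h1 := continuous_apply_rightTranslate_of_mem_wap (H F)
    (pairing (MeasureAlgebra.ofMeasure P hP))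
  refine (Complex.continuous_re.comp h1).congr fun y => ?_
  rw [Function.comp_apply, pairing_ofMeasure]
  change (∫ x, ((f (x * y) : ℝ) : ℂ) ∂p).re = _
  rw [integral_complex_ofReal, Complex.ofReal_re]

variable [LocallyCompactSpace S]

/-- The functions `y ↦ ∫ h(xy) dp(x)`, for compactly supported `h` with values in `[0, 1]`,
come close to the total mass of `p` locally uniformly in `y`: no mass of the translates of `p`
escapes to infinity. -/
theorem exists_eventually_integral_one_sub_lt (H : ∀ f : C₀(S, ℂ), f.toBCF ∈ wap S) (p : Measure S)
    [IsFiniteMeasure p] [p.Regular] (y₀ : S) {ε : ℝ} (hε : 0 < ε) :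
    ∃ h : C_c(S, ℝ), (∀ x, h x ∈ Set.Icc 0 1) ∧
      ∀ᶠ y in 𝓝 y₀, ∫ x, (1 - h (x * y)) ∂p < ε := by
  obtain ⟨L, -, hL, hpL⟩ := MeasurableSet.univ.exists_isCompact_sdiff_lt (μ := p)
    (measure_ne_top _ _) (ENNReal.ofReal_pos.2 hε).ne'
  obtain ⟨f, hf1, -, hfs, hf01⟩ := exists_continuous_one_zero_of_isCompact
    (hL.image (continuous_mul_const y₀)) isClosed_empty (Set.disjoint_empty _)
  let h : C_c(S, ℝ) := ⟨f, hfs⟩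
  -- `h` is `1` on `L * y₀`, so the bound holds at `y₀`; by continuity it persists nearby
  have hcont : Continuous fun y => ∫ x, (1 - h (x * y)) ∂p := by
    have h1 : ∀ y, ∫ x, (1 - h (x * y)) ∂p = p.real Set.univ - ∫ x, h (x * y) ∂p := fun y => by
      rw [integral_sub (integrable_const _)
        (integrable_compactlySupported_comp_mul_right p h y)]
      simp
    simp only [h1]
    exact continuous_const.sub (continuous_integral_comp_mul_right_of_hasCompactSupport H p h)
  refine ⟨h, hf01, hcont.continuousAt.eventually_lt continuousAt_const ?_⟩
  calc ∫ x, (1 - h (x * y₀)) ∂p ≤ ∫ x, Lᶜ.indicator (fun _ => (1 : ℝ)) x ∂p := by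
        refine integral_mono ((integrable_const _).sub
          (integrable_compactlySupported_comp_mul_right p h y₀))
          ((integrable_const _).indicator hL.measurableSet.compl) fun x => ?_
        by_cases hx : x ∈ L
        · have h2 : h (x * y₀) = 1 := hf1 ⟨x, hx, rfl⟩
          simp [h2, hx]
        · have h2 : 0 ≤ h (x * y₀) := (hf01 _).1
          rw [Set.indicator_of_mem hx]
          linarith
    _ = p.real Lᶜ := integral_indicator_one hL.measurableSet.compl
    _ < ε := by
        rw [Measure.real, ← ENNReal.lt_ofReal_iff_toReal_lt (measure_ne_top _ _),
          Set.compl_eq_univ_sdiff]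
        exact hpL

/-- A bounded function is replaced by compactly supported ones, locally uniformly in `y`. -/
theorem continuous_integral_comp_mul_right (H : ∀ f : C₀(S, ℂ), f.toBCF ∈ wap S) (p : Measure S)
    [IsFiniteMeasure p] [p.Regular] (g : S →ᵇ ℝ) : Continuous fun y => ∫ x, g (x * y) ∂p := by
  refine continuous_iff_continuousAt.2 fun y₀ =>
    continuousAt_of_locally_uniform_approx_of_continuousAt fun u hu => ?_
  obtain ⟨ε, hε, hεu⟩ := Metric.mem_uniformity_dist.1 hu
  have hδ : 0 < ε / (‖g‖ + 1) := by positivity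
  obtain ⟨h, hh, hy⟩ := exists_eventually_integral_one_sub_lt H p y₀ hδ
  refine ⟨_, hy, fun y => ∫ x, cutoff h g (x * y) ∂p,
    (continuous_integral_comp_mul_right_of_hasCompactSupport H p _).continuousAt,
    fun y hy => hεu ?_⟩
  rw [dist_eq_norm]
  refine (norm_integral_sub_integral_cutoff_le p hh g y).trans_lt ?_
  have h1 : ∫ x, (1 - h (x * y)) ∂p < ε / (‖g‖ + 1) := hy
  have h2 : ‖g‖ * ∫ x, (1 - h (x * y)) ∂p ≤ ‖g‖ * (ε / (‖g‖ + 1)) := by gcongr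
  refine h2.trans_lt ?_
  rw [mul_div_assoc', div_lt_iff₀ (by positivity)]
  nlinarith

theorem integrable_integral_comp_mul_right (H : ∀ f : C₀(S, ℂ), f.toBCF ∈ wap S) (p q : Measure S)
    [IsFiniteMeasure p] [p.Regular] [IsFiniteMeasure q] (g : S →ᵇ ℝ) :
    Integrable (fun y => ∫ x, g (x * y) ∂p) q :=
  .of_bound (continuous_integral_comp_mul_right H p g).aestronglyMeasurable _
    (.of_forall fun y => norm_integral_comp_mul_right_le p g y)

/-- The cut-off function can be chosen uniformly for `y` in a compact set, as a maximum of finitely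
many local ones. -/
theorem exists_forall_mem_integral_one_sub_le (H : ∀ f : C₀(S, ℂ), f.toBCF ∈ wap S) (p : Measure S)
    [IsFiniteMeasure p] [p.Regular] {M : Set S} (hM : IsCompact M) {ε : ℝ} (hε : 0 < ε) :
    ∃ h : C_c(S, ℝ), (∀ x, h x ∈ Set.Icc 0 1) ∧ ∀ y ∈ M, ∫ x, (1 - h (x * y)) ∂p ≤ ε := by
  have hint : ∀ (h : C_c(S, ℝ)) y, Integrable (fun x => 1 - h (x * y)) p := fun h y =>
    (integrable_const _).sub (integrable_compactlySupported_comp_mul_right p h y)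
  refine hM.induction_on (p := fun M => ∃ h : C_c(S, ℝ), (∀ x, h x ∈ Set.Icc 0 1) ∧
    ∀ y ∈ M, ∫ x, (1 - h (x * y)) ∂p ≤ ε) ⟨0, by simp, by simp⟩ ?_ ?_ ?_
  · rintro s t hst ⟨h, hh, hy⟩
    exact ⟨h, hh, fun y hys => hy y (hst hys)⟩
  · rintro s t ⟨h, hh, hy⟩ ⟨k, hk, hy'⟩
    refine ⟨h ⊔ k, fun x => ⟨le_sup_of_le_left (hh x).1, sup_le (hh x).2 (hk x).2⟩, ?_⟩
    rintro y (hys | hyt)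
    · exact (integral_mono (hint _ y) (hint _ y) fun x =>
        sub_le_sub_left (le_sup_left (a := h (x * y))) 1).trans (hy y hys)
    · exact (integral_mono (hint _ y) (hint _ y) fun x =>
        sub_le_sub_left (le_sup_right (b := k (x * y))) 1).trans (hy' y hyt)
  · intro y _
    obtain ⟨h, hh, hy⟩ := exists_eventually_integral_one_sub_lt H p y hε
    exact ⟨_, mem_nhdsWithin_of_mem_nhds hy, h, hh, fun z hz => le_of_lt hz⟩

/-- No mass of the convolution of `p` and `q` escapes to infinity. -/
theorem exists_integral_integral_one_sub_le (H : ∀ f : C₀(S, ℂ), f.toBCF ∈ wap S) (p q : Measure S)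
    [IsFiniteMeasure p] [p.Regular] [IsFiniteMeasure q] [q.Regular] {ε : ℝ} (hε : 0 < ε) :
    ∃ h : C_c(S, ℝ), (∀ x, h x ∈ Set.Icc 0 1) ∧ ∫ y, ∫ x, (1 - h (x * y)) ∂p ∂q ≤ ε := by
  set a := p.real Set.univ
  set b := q.real Set.univ
  have ha : 0 ≤ a := measureReal_nonneg
  have hb : 0 ≤ b := measureReal_nonneg
  have hδ : 0 < ε / (a + b + 1) := by positivity
  set δ := ε / (a + b + 1)
  obtain ⟨M, -, hM, hqM⟩ := MeasurableSet.univ.exists_isCompact_sdiff_lt (μ := q)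
    (measure_ne_top _ _) (ENNReal.ofReal_pos.2 hδ).ne'
  obtain ⟨h, hh, hhM⟩ := exists_forall_mem_integral_one_sub_le H p hM hδ
  refine ⟨h, hh, ?_⟩
  have hint : ∀ y, Integrable (fun x => h (x * y)) p :=
    integrable_compactlySupported_comp_mul_right p h
  have h1 : Integrable (fun y => ∫ x, (1 - h (x * y)) ∂p) q :=
    integrable_integral_comp_mul_right H p q (1 - h.toBoundedContinuousFunction)
  have hqM' : q.real Mᶜ ≤ δ := by
    refine ENNReal.toReal_le_of_le_ofReal hδ.le ?_
    rw [Set.compl_eq_univ_sdiff]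
    exact hqM.le
  calc ∫ y, ∫ x, (1 - h (x * y)) ∂p ∂q
      ≤ ∫ y, (δ + Mᶜ.indicator (fun _ => a) y) ∂q := by
        refine integral_mono h1 ((integrable_const _).add
          ((integrable_const _).indicator hM.measurableSet.compl)) fun y => ?_
        by_cases hy : y ∈ M
        · simpa [hy] using hhM y hy
        · have h2 : ∫ x, (1 - h (x * y)) ∂p ≤ a := by
            rw [integral_sub (integrable_const _) (hint y), integral_const, smul_eq_mul, mul_one]
            exact sub_le_self _ (integral_nonneg fun x => (hh _).1)
          rw [Set.indicator_of_mem hy]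
          linarith
    _ = b * δ + q.real Mᶜ * a := by
        rw [integral_add (integrable_const _)
          ((integrable_const _).indicator hM.measurableSet.compl),
          integral_indicator_const _ hM.measurableSet.compl]
        simp [b]
    _ ≤ b * δ + δ * a := by gcongr
    _ ≤ (a + b + 1) * δ := by nlinarith
    _ = ε := mul_div_cancel₀ _ (by positivity)

/-- The convolution of two positive measures is the measure that the Riesz representation theorem
attaches to `f ↦ ∫∫ f(xy) dp(x) dq(y)` on the compactly supported functions. The formula extends to
all bounded functions because no mass is lost at infinity. -/
theorem exists_measure_integral_eq_integral_integral (H : ∀ f : C₀(S, ℂ), f.toBCF ∈ wap S)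
    (p q : Measure S) [IsFiniteMeasure p] [p.Regular] [IsFiniteMeasure q] [q.Regular] :
    ∃ ρ : FiniteMeasure S, (ρ : Measure S).Regular ∧
      ∀ g : S →ᵇ ℝ, ∫ z, g z ∂(ρ : Measure S) = ∫ y, ∫ x, g (x * y) ∂p ∂q := by
  have hx : ∀ (f : C_c(S, ℝ)) y, Integrable (fun x => f (x * y)) p := fun f y =>
    integrable_compactlySupported_comp_mul_right p f y
  have hxy : ∀ f : C_c(S, ℝ), Integrable (fun y => ∫ x, f (x * y) ∂p) q := fun f =>
    integrable_integral_comp_mul_right H p q f.toBoundedContinuousFunction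
  let Λ : C_c(S, ℝ) →ₚ[ℝ] ℝ :=
    { toFun f := ∫ y, ∫ x, f (x * y) ∂p ∂q
      map_add' f g := by
        rw [← integral_add (hxy f) (hxy g)]
        exact integral_congr_ae (.of_forall fun y => integral_add (hx f y) (hx g y))
      map_smul' c f := by
        simp only [CompactlySupportedContinuousMap.smul_apply, integral_smul, RingHom.id_apply]
      monotone' f g hfg := integral_mono (hxy f) (hxy g) fun y =>
        integral_mono (hx f y) (hx g y) fun x => hfg (x * y) }
  have hΛ : ∀ f, Λ f = ∫ y, ∫ x, f (x * y) ∂p ∂q := fun f => rfl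
  set ρ := RealRMK.rieszMeasure Λ with hρ
  have hone : ∀ h : C_c(S, ℝ), ∫ y, ∫ x, (1 - h (x * y)) ∂p ∂q =
      p.real Set.univ * q.real Set.univ - Λ h := fun h => by
    have h1 : ∀ y, ∫ x, (1 - h (x * y)) ∂p = p.real Set.univ - ∫ x, h (x * y) ∂p := fun y => by
      rw [integral_sub (integrable_const _) (hx h y)]
      simp
    simp only [h1]
    rw [integral_sub (integrable_const _) (hxy h), hΛ]
    simp [mul_comm]
  have hmass : ρ Set.univ ≤ ENNReal.ofReal (p.real Set.univ * q.real Set.univ) := by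
    rw [isOpen_univ.measure_eq_iSup_isCompact]
    refine iSup₂_le fun K _ => iSup_le fun hK => ?_
    obtain ⟨f, hf1, -, hfs, hf01⟩ :=
      exists_continuous_one_zero_of_isCompact hK isClosed_empty (Set.disjoint_empty _)
    refine (RealRMK.rieszMeasure_le_of_eq_one Λ (f := ⟨f, hfs⟩) (fun x => (hf01 x).1) hK
      fun x hxK => hf1 hxK).trans (ENNReal.ofReal_le_ofReal ?_)
    have h2 := hone ⟨f, hfs⟩
    have h3 : 0 ≤ ∫ y, ∫ x, (1 - (⟨f, hfs⟩ : C_c(S, ℝ)) (x * y)) ∂p ∂q :=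
      integral_nonneg fun y => integral_nonneg fun x => sub_nonneg.2 (hf01 _).2
    linarith
  have hfin : IsFiniteMeasure ρ := ⟨hmass.trans_lt ENNReal.ofReal_lt_top⟩
  have hmass' : ρ.real Set.univ ≤ p.real Set.univ * q.real Set.univ :=
    ENNReal.toReal_le_of_le_ofReal (by positivity) hmass
  refine ⟨⟨ρ, hfin⟩, inferInstanceAs ρ.Regular, fun g => ?_⟩
  change ∫ z, g z ∂ρ = _
  -- cut `g` off; on both sides the error is controlled by the mass outside of `h`
  refine eq_of_abs_sub_le_all fun ε hε => ?_
  have hδ : 0 < ε / (2 * (‖g‖ + 1)) := by positivity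
  obtain ⟨h, hh, hle⟩ := exists_integral_integral_one_sub_le H p q hδ
  have h1 : ∫ z, cutoff h g z ∂ρ = ∫ y, ∫ x, cutoff h g (x * y) ∂p ∂q :=
    RealRMK.integral_rieszMeasure Λ _
  have h2 : |∫ z, g z ∂ρ - ∫ z, cutoff h g z ∂ρ| ≤ ‖g‖ * ∫ z, (1 - h z) ∂ρ := by
    rw [← integral_sub (g.integrable _) (cutoff h g).integrable, ← integral_const_mul]
    exact norm_integral_le_of_norm_le (((integrable_const _).sub h.integrable).const_mul _)
      (.of_forall fun x => norm_sub_cutoff_le hh g _)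
  have h3 : ∫ z, (1 - h z) ∂ρ ≤ ∫ y, ∫ x, (1 - h (x * y)) ∂p ∂q := by
    rw [hone, integral_sub (integrable_const _) h.integrable, RealRMK.integral_rieszMeasure]
    simpa using hmass'
  have h4 : |∫ y, ∫ x, g (x * y) ∂p ∂q - ∫ y, ∫ x, cutoff h g (x * y) ∂p ∂q| ≤
      ‖g‖ * ∫ y, ∫ x, (1 - h (x * y)) ∂p ∂q := by
    rw [← integral_sub (integrable_integral_comp_mul_right H p q g) (hxy _), ← integral_const_mul]
    exact norm_integral_le_of_norm_le ((integrable_integral_comp_mul_right H p q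
      (1 - h.toBoundedContinuousFunction)).const_mul _)
      (.of_forall fun y => norm_integral_sub_integral_cutoff_le p hh g y)
  have h5 : ‖g‖ * (ε / (2 * (‖g‖ + 1))) ≤ ε / 2 := by
    rw [mul_div_assoc', div_le_div_iff₀ (by positivity) (by positivity)]
    nlinarith
  have h6 := mul_le_mul_of_nonneg_left h3 (norm_nonneg g)
  have h7 := mul_le_mul_of_nonneg_left hle (norm_nonneg g)
  rw [h1] at h2
  rw [abs_le] at h2 h4 ⊢
  constructor <;> linarith [h2.1, h2.2, h4.1, h4.2]

theorem integral_eq_integral_re_add_integral_im {X : Type*} {mX : MeasurableSpace X}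
    {p : Measure X} {f : X → ℂ} (hf : Integrable f p) :
    ∫ x, f x ∂p = ((∫ x, (f x).re ∂p : ℝ) : ℂ) + ((∫ x, (f x).im ∂p : ℝ) : ℂ) * Complex.I :=
  (integral_re_add_im hf).symm

theorem continuous_integral_rightTranslate (H : ∀ f : C₀(S, ℂ), f.toBCF ∈ wap S) (p : Measure S)
    [IsFiniteMeasure p] [p.Regular] (g : S →ᵇ ℂ) :
    Continuous fun y => ∫ x, rightTranslate y g x ∂p := by
  have hre := continuous_integral_comp_mul_right H p (Complex.reCLM.compLeftContinuousBounded S g)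
  have him := continuous_integral_comp_mul_right H p (Complex.imCLM.compLeftContinuousBounded S g)
  refine ((Complex.continuous_ofReal.comp hre).add
    ((Complex.continuous_ofReal.comp him).mul
      (continuous_const (y := Complex.I)))).congr fun y => ?_
  exact (integral_eq_integral_re_add_integral_im ((rightTranslate y g).integrable p)).symm

theorem integrable_integral_rightTranslate (H : ∀ f : C₀(S, ℂ), f.toBCF ∈ wap S) (p q : Measure S)
    [IsFiniteMeasure p] [p.Regular] [IsFiniteMeasure q] (g : S →ᵇ ℂ) :
    Integrable (fun y => ∫ x, rightTranslate y g x ∂p) q :=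
  .of_bound (continuous_integral_rightTranslate H p g).aestronglyMeasurable
    (‖g‖ * p.real Set.univ) (.of_forall fun _ =>
      norm_integral_le_of_norm_le_const (.of_forall fun _ => g.norm_coe_le_norm _))

theorem exists_measure_integral_eq_integral_integral_rightTranslate
    (H : ∀ f : C₀(S, ℂ), f.toBCF ∈ wap S)
    (p q : Measure S) [IsFiniteMeasure p] [p.Regular] [IsFiniteMeasure q] [q.Regular] :
    ∃ ρ : FiniteMeasure S, (ρ : Measure S).Regular ∧
      ∀ g : S →ᵇ ℂ, ∫ z, g z ∂(ρ : Measure S) = ∫ y, ∫ x, rightTranslate y g x ∂p ∂q := by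
  obtain ⟨ρ, hρ, h⟩ := exists_measure_integral_eq_integral_integral H p q
  refine ⟨ρ, hρ, fun g => ?_⟩
  have hre := h (Complex.reCLM.compLeftContinuousBounded S g)
  have him := h (Complex.imCLM.compLeftContinuousBounded S g)
  have h1 : ∀ y, ∫ x, rightTranslate y g x ∂p =
      ((∫ x, (g (x * y)).re ∂p : ℝ) : ℂ) + ((∫ x, (g (x * y)).im ∂p : ℝ) : ℂ) * Complex.I :=
    fun y => integral_eq_integral_re_add_integral_im ((rightTranslate y g).integrable p)
  rw [integral_eq_integral_re_add_integral_im (g.integrable _),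
    integral_eq_integral_re_add_integral_im (integrable_integral_rightTranslate H p q g)]
  simp only [h1]
  simp only [Complex.add_re, Complex.ofReal_re, Complex.mul_re, Complex.I_re, mul_zero,
    Complex.ofReal_im, Complex.I_im, mul_one, sub_self, add_zero, Complex.add_im, Complex.mul_im,
    zero_add]
  exact congrArg₂ (fun a b : ℝ => (a : ℂ) + b * Complex.I) hre him

/-- The convolution of complex measures is obtained bilinearly from that of their Jordan parts. -/
theorem isConvolutionModel_pairing (H : ∀ f : C₀(S, ℂ), f.toBCF ∈ wap S) :
    IsConvolutionModel (pairing (S := S)) where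
  norm_le := norm_pairing_le
  norming μ ε hε := by
    obtain ⟨f, hf1, hf⟩ := exists_norm_sub_le_norm_pairing μ hε
    exact ⟨f.toBCF, H f, hf1, hf⟩
  decomposition μ := by
    obtain ⟨p, hp, hle, hμ⟩ := exists_eq_sum_ofMeasure μ
    exact ⟨fun k => p k, fun k => inferInstance, hle, pairing_eq_sum hμ⟩
  continuous_average μ g := by
    obtain ⟨p, hp, -, hμ⟩ := exists_eq_sum_ofMeasure μ
    simp only [pairing_eq_sum hμ]
    exact continuous_finsetSum _ fun k _ =>
      continuous_const.mul (continuous_integral_rightTranslate H (p k : Measure S) g)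
  exists_convolution μ ν := by
    obtain ⟨p, hp, -, hμ⟩ := exists_eq_sum_ofMeasure μ
    obtain ⟨q, hq, -, hν⟩ := exists_eq_sum_ofMeasure ν
    choose ρ hρ hρpq using fun k l => exists_measure_integral_eq_integral_integral_rightTranslate H
      (p k : Measure S) (q l : Measure S)
    refine ⟨∑ l : Fin 4, Complex.I ^ (l : ℕ) • ∑ k : Fin 4, Complex.I ^ (k : ℕ) •
      MeasureAlgebra.ofMeasure (ρ k l) (hρ k l), fun g h hgh => ?_⟩
    rw [pairing_eq_sum hν]
    simp only [map_sum, map_smul, sum_apply, smul_apply, smul_eq_mul, pairing_ofMeasure, hρpq]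
    refine Finset.sum_congr rfl fun l _ => ?_
    congr 1
    simp only [hgh, pairing_eq_sum hμ]
    rw [integral_finsetSum _ fun k _ => (integrable_integral_rightTranslate H (p k : Measure S)
      (q l : Measure S) g).const_mul _]
    simp only [integral_const_mul]

end Convolution

/-! ### Convolution in `ℓ¹(S)` -/

section Ell1

theorem Ell1.summable_norm {S : Type*} (a : Ell1 S) : Summable fun s => ‖a s‖ := by
  simpa using (lp.memℓp a).summable (by simp)

theorem Ell1.norm_eq_tsum {S : Type*} (a : Ell1 S) : ‖a‖ = ∑' s, ‖a s‖ := by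
  simpa using lp.norm_eq_tsum_rpow (p := 1) (by simp) a

theorem summable_mul_apply {S : Type*} [TopologicalSpace S] (a : Ell1 S) (g : S →ᵇ ℂ) :
    Summable fun s => a s * g s := by
  refine (a.summable_norm.mul_right ‖g‖).of_norm_bounded fun s => ?_
  rw [norm_mul]
  gcongr
  exact g.norm_coe_le_norm s

theorem norm_tsum_mul_apply_le {S : Type*} [TopologicalSpace S] (a : Ell1 S) (g : S →ᵇ ℂ) :
    ‖∑' s, a s * g s‖ ≤ ‖a‖ * ‖g‖ := by
  rw [a.norm_eq_tsum, ← tsum_mul_right]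
  refine tsum_of_norm_bounded (a.summable_norm.mul_right ‖g‖).hasSum fun s => ?_
  rw [norm_mul]
  gcongr
  exact g.norm_coe_le_norm s

/-- The pairing `(a, g) ↦ ∑ a(s) g(s)` of `ℓ¹(S)` with the bounded functions. -/
noncomputable def pairingEll1 (S : Type*) [TopologicalSpace S] :
    Ell1 S →L[ℂ] StrongDual ℂ (S →ᵇ ℂ) :=
  LinearMap.mkContinuous₂
    (LinearMap.mk₂ ℂ (fun (a : Ell1 S) (g : S →ᵇ ℂ) => ∑' s, a s * g s)
      (fun a b g => by
        rw [← (summable_mul_apply a g).tsum_add (summable_mul_apply b g)]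
        exact tsum_congr fun s => by simp [add_mul])
      (fun c a g => by
        rw [smul_eq_mul, ← tsum_mul_left]
        exact tsum_congr fun s => by simp [mul_assoc])
      (fun a g g' => by
        rw [← (summable_mul_apply a g).tsum_add (summable_mul_apply a g')]
        exact tsum_congr fun s => by simp [mul_add])
      (fun c a g => by
        rw [smul_eq_mul, ← tsum_mul_left]
        exact tsum_congr fun s => by simp [mul_left_comm])) 1
    fun a g => by
      rw [one_mul]
      exact norm_tsum_mul_apply_le a g

theorem pairingEll1_apply {S : Type*} [TopologicalSpace S] (a : Ell1 S) (g : S →ᵇ ℂ) :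
    pairingEll1 S a g = ∑' s, a s * g s := rfl

variable {S : Type*}

section Mul

variable [Mul S]

theorem summable_norm_mul (a b : Ell1 S) :
    Summable fun p : Σ s : S, {p : S × S // p.1 * p.2 = s} => ‖a p.2.1.1 * b p.2.1.2‖ :=
  (Equiv.sigmaFiberEquiv fun p : S × S => p.1 * p.2).summable_iff
    (f := fun p : S × S => ‖a p.1 * b p.2‖) |>.2 <| by
      simpa only [norm_mul] using a.summable_norm.mul_of_nonneg b.summable_norm
        (fun _ => norm_nonneg _) fun _ => norm_nonneg _

/-- The convolution of two elements of `ℓ¹(S)`: the sum of `a x * b y` over each fiber of the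
multiplication. -/
noncomputable def convolutionEll1 (a b : Ell1 S) : Ell1 S :=
  ⟨fun s => ∑' p : {p : S × S // p.1 * p.2 = s}, a p.1.1 * b p.1.2, by
    refine memℓp_gen ?_
    simp only [ENNReal.toReal_one, Real.rpow_one]
    exact (summable_norm_mul a b).sigma.of_nonneg_of_le (fun _ => norm_nonneg _) fun s =>
      norm_tsum_le_tsum_norm ((summable_norm_mul a b).sigma_factor s)⟩

theorem isConvolutionEll1_convolutionEll1 (a b : Ell1 S) :
    IsConvolutionEll1 a b (convolutionEll1 a b) := fun s =>
  ((summable_norm_mul a b).sigma_factor s).of_norm.hasSum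

theorem pairingEll1_convolutionEll1 [TopologicalSpace S] (a b : Ell1 S) (g : S →ᵇ ℂ) :
    pairingEll1 S (convolutionEll1 a b) g = ∑' y, b y * ∑' x, a x * g (x * y) := by
  have hF : Summable fun p : S × S => a p.1 * b p.2 * g (p.1 * p.2) := by
    refine Summable.of_norm_bounded (g := fun p : S × S => ‖a p.1‖ * ‖b p.2‖ * ‖g‖)
      ((a.summable_norm.mul_of_nonneg b.summable_norm (fun _ => norm_nonneg _)
        fun _ => norm_nonneg _).mul_right _) fun p => ?_
    rw [norm_mul, norm_mul]
    gcongr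
    exact g.norm_coe_le_norm _
  let e := Equiv.sigmaFiberEquiv fun p : S × S => p.1 * p.2
  calc pairingEll1 S (convolutionEll1 a b) g
      = ∑' s, ∑' p : {p : S × S // p.1 * p.2 = s}, a p.1.1 * b p.1.2 * g (p.1.1 * p.1.2) := by
        rw [pairingEll1_apply]
        refine tsum_congr fun s => ?_
        have h1 : convolutionEll1 a b s =
          ∑' p : {p : S × S // p.1 * p.2 = s}, a p.1.1 * b p.1.2 := rfl
        rw [h1, ← tsum_mul_right]
        exact tsum_congr fun p => by rw [p.2]
    _ = ∑' q : Σ s : S, {p : S × S // p.1 * p.2 = s},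
          a (e q).1 * b (e q).2 * g ((e q).1 * (e q).2) :=
        ((e.summable_iff.2 hF).tsum_sigma).symm
    _ = ∑' p : S × S, a p.1 * b p.2 * g (p.1 * p.2) :=
        e.tsum_eq fun p : S × S => a p.1 * b p.2 * g (p.1 * p.2)
    _ = ∑' y, ∑' x, a x * b y * g (x * y) := by
        rw [← (Equiv.prodComm S S).tsum_eq]
        exact hF.prod_symm.tsum_prod
    _ = ∑' y, b y * ∑' x, a x * g (x * y) := by
        refine tsum_congr fun y => ?_
        rw [← tsum_mul_left]
        exact tsum_congr fun x => by ring

end Mul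

section Discrete

variable [TopologicalSpace S] [DiscreteTopology S]

/-- The norm of `ℓ¹(S)` is recovered from the finitely supported functions. -/
theorem exists_norm_sub_le_norm_pairingEll1 (a : Ell1 S) {ε : ℝ} (hε : 0 < ε) :
    ∃ f : S →ᵇ ℂ, Tendsto f cofinite (𝓝 0) ∧ ‖f‖ ≤ 1 ∧ ‖a‖ - ε ≤ ‖pairingEll1 S a f‖ := by
  classical
  have h1 : ∀ᶠ F : Finset S in atTop, ‖a‖ - ε < ∑ s ∈ F, ‖a s‖ := by
    refine a.summable_norm.hasSum.eventually_const_lt ?_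
    rw [← a.norm_eq_tsum]
    linarith
  obtain ⟨F, hF⟩ := h1.exists
  let f₀ : S → ℂ := fun s => if s ∈ F then (starRingEnd ℂ) (a s) / ‖a s‖ else 0
  have hf₀ : ∀ s, ‖f₀ s‖ ≤ 1 := fun s => by
    by_cases hs : s ∈ F
    · simpa [f₀, hs] using div_self_le_one ‖a s‖
    · simp [f₀, hs]
  let f : S →ᵇ ℂ := .ofNormedAddCommGroup f₀ continuous_of_discreteTopology 1 hf₀
  have haf : ∀ s ∈ F, a s * f s = ‖a s‖ := fun s hs => by
    have h2 : f s = (starRingEnd ℂ) (a s) / ‖a s‖ := if_pos hs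
    rcases eq_or_ne (a s) 0 with h0 | h0
    · simp [h0]
    · have h3 : (‖a s‖ : ℂ) ≠ 0 := by simpa using h0
      rw [h2, mul_div_assoc', Complex.mul_conj, Complex.normSq_eq_norm_sq]
      push_cast
      field_simp
  refine ⟨f, ?_, (BoundedContinuousFunction.norm_le zero_le_one).2 hf₀, ?_⟩
  · refine tendsto_const_nhds.congr' ?_
    filter_upwards [F.eventually_cofinite_notMem] with s hs
    exact (if_neg hs).symm
  · rw [pairingEll1_apply, tsum_eq_sum fun s hs => by
      have h2 : f s = 0 := if_neg hs
      rw [h2, mul_zero], Finset.sum_congr rfl haf, ← Complex.ofReal_sum, Complex.norm_real]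
    exact hF.le.trans (le_abs_self _)

variable [MeasurableSpace S] [BorelSpace S]

/-- A nonnegative summable function, as the measure with these point masses. -/
theorem exists_measure_integral_eq_tsum (a : Ell1 S) {c : S → ℝ} (hc0 : ∀ s, 0 ≤ c s)
    (hc : ∀ s, c s ≤ ‖a s‖) :
    ∃ p : Measure S, IsFiniteMeasure p ∧ p.real Set.univ ≤ ‖a‖ ∧
      ∀ g : S →ᵇ ℂ, HasSum (fun s => c s * g s) (∫ x, g x ∂p) := by
  let m : S → Measure S := fun s => ENNReal.ofReal (c s) • Measure.dirac s
  have hcs : Summable c := a.summable_norm.of_nonneg_of_le hc0 hc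
  have h1 : Measure.sum m Set.univ = ENNReal.ofReal (∑' s, c s) := by
    rw [Measure.sum_apply _ MeasurableSet.univ, ENNReal.ofReal_tsum_of_nonneg hc0 hcs]
    simp [m]
  have hfin : IsFiniteMeasure (Measure.sum m) := ⟨h1 ▸ ENNReal.ofReal_lt_top⟩
  refine ⟨Measure.sum m, hfin, ?_, fun g => ?_⟩
  · rw [Measure.real, h1, ENNReal.toReal_ofReal (tsum_nonneg hc0), a.norm_eq_tsum]
    exact hcs.tsum_le_tsum hc a.summable_norm
  · refine (hasSum_integral_measure (g.integrable (Measure.sum m))).congr_fun fun s => ?_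
    simp [m, integral_smul_measure, ENNReal.toReal_ofReal (hc0 s)]

variable (S) in
theorem exists_decomposition_pairingEll1 (a : Ell1 S) :
    ∃ p : Fin 4 → Measure S, (∀ k, IsFiniteMeasure (p k)) ∧ (∀ k, (p k).real Set.univ ≤ ‖a‖) ∧
      ∀ g, pairingEll1 S a g = ∑ k : Fin 4, Complex.I ^ (k : ℕ) * ∫ x, g x ∂p k := by
  let c : Fin 4 → S → ℝ := ![fun s => max (a s).re 0, fun s => max (a s).im 0,
    fun s => max (-(a s).re) 0, fun s => max (-(a s).im) 0]
  have hc0 : ∀ k s, 0 ≤ c k s := fun k s => by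
    fin_cases k <;> exact le_max_right _ _
  have hre := fun s => abs_le.1 (Complex.abs_re_le_norm (a s))
  have him := fun s => abs_le.1 (Complex.abs_im_le_norm (a s))
  have hc : ∀ k s, c k s ≤ ‖a s‖ := fun k s => by
    fin_cases k <;> refine max_le ?_ (norm_nonneg _) <;> linarith [hre s, him s]
  have hsum : ∀ s, a s = ∑ k : Fin 4, Complex.I ^ (k : ℕ) * (c k s : ℂ) := fun s => by
    have h1 : ∀ r : ℝ, r = max r 0 - max (-r) 0 := fun r => by
      rcases le_total r 0 with h | h <;> simp [h]
    rw [Fin.sum_univ_four]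
    refine Complex.ext ((h1 _).trans ?_) ((h1 _).trans ?_) <;> simp [c, pow_succ, sub_eq_add_neg]
  choose p hp hpa hpg using fun k => exists_measure_integral_eq_tsum a (hc0 k) (hc k)
  refine ⟨p, hp, hpa, fun g => ?_⟩
  rw [pairingEll1_apply]
  refine (HasSum.congr_fun (hasSum_sum fun k _ => (hpg k g).mul_left (Complex.I ^ (k : ℕ)))
    fun s => ?_).tsum_eq
  rw [hsum s, Finset.sum_mul]
  simp only [mul_assoc]

theorem isConvolutionModel_pairingEll1 [Semigroup S] [SeparatelyContinuousMul S]
    (H : ∀ f : S →ᵇ ℂ, Tendsto f cofinite (𝓝 0) → f ∈ wap S) :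
    IsConvolutionModel (pairingEll1 S) where
  norm_le a := ContinuousLinearMap.opNorm_le_bound _ (norm_nonneg a) (norm_tsum_mul_apply_le a)
  norming a ε hε := by
    obtain ⟨f, hf, hf1, hle⟩ := exists_norm_sub_le_norm_pairingEll1 a hε
    exact ⟨f, H f hf, hf1, hle⟩
  decomposition := exists_decomposition_pairingEll1 S
  continuous_average _ _ := continuous_of_discreteTopology
  exists_convolution a b := ⟨convolutionEll1 a b, fun g h hgh => by
    rw [pairingEll1_convolutionEll1, pairingEll1_apply]
    simp only [hgh, pairingEll1_apply, rightTranslate_apply]⟩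

end Discrete

end Ell1

end WAPAlg

theorem mainTheorem3 {S : Type*} [TopologicalSpace S] [T2Space S] [LocallyCompactSpace S]
    [MeasurableSpace S] [BorelSpace S] [Semigroup S] [SeparatelyContinuousMul S] :
    ((∀ f : C₀(S, ℂ), f.toBCF ∈ WAPAlg.wap S) →
      ∃ conv : WAPAlg.MeasureAlgebra S →L[ℂ] WAPAlg.MeasureAlgebra S →L[ℂ] WAPAlg.MeasureAlgebra S,
        (∀ μ ν, WAPAlg.IsConvolution μ ν (conv μ ν)) ∧ WAPAlg.IsWAPAlgebra conv) ∧
    (DiscreteTopology S →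
      (∀ f : S →ᵇ ℂ, Tendsto f cofinite (𝓝 0) → f ∈ WAPAlg.wap S) →
      ∃ conv : WAPAlg.Ell1 S →L[ℂ] WAPAlg.Ell1 S →L[ℂ] WAPAlg.Ell1 S,
        (∀ f g, WAPAlg.IsConvolutionEll1 f g (conv f g)) ∧ WAPAlg.IsWAPAlgebra conv) := by
  refine ⟨fun H => ?_, fun _ H => ?_⟩
  · have h := WAPAlg.isConvolutionModel_pairing H
    exact ⟨h.mul, fun μ ν f => ⟨(h.average μ f.toBCF).integrable _, h.apply_mul μ ν f.toBCF⟩,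
      h.isWAPAlgebra⟩
  · have h := WAPAlg.isConvolutionModel_pairingEll1 H
    refine ⟨h.mul, fun a b => ?_, h.isWAPAlgebra⟩
    have h1 : h.mul a b = WAPAlg.convolutionEll1 a b := h.ext fun g => by
      rw [h.apply_mul, WAPAlg.pairingEll1_convolutionEll1, WAPAlg.pairingEll1_apply]
      simp only [h.average_apply, WAPAlg.pairingEll1_apply, WAPAlg.rightTranslate_apply]
    rw [h1]
    exact WAPAlg.isConvolutionEll1_convolutionEll1 a b
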